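/- **Notation.** Let $n\in\mathbb N=\{1,2,\dots\}$. Functions on $\mathbb R^n$ are complex valued, $|B|$ is the Lebesgue measure of $B$, and "ball" means an open Euclidean ball of positive radius. *Inhomogeneous Lipschitz space.* For $a\in(0,\infty)$, $\Lambda_a(\mathbb R^n)$ is the set of all measurable functions $f$ that agree almost everywhere with a continuous function $\widetilde f$ such that $$\|f\|_{\Lambda_a(\mathbb R^n)}:=\|f\|_{L^\infty(\mathbb R^n)}+\sup_{x\in\mathbb R^n}\ \sup_{h\in\mathbb R^n\setminus\{0\}}\frac{|D_h^{\lfloor a\rfloor+1}\widetilde f(x)|}{|h|^a}<\infty,$$ where $D_hu(x):=u(x+h)-u(x)$ and $D_h^{k}$ is its $k$-th iterate. A function $g$ on $\mathbb R^n$ is a *pointwise multiplier* of $\Lambda_a(\mathbb R^n)$ if there is a constant $K\in(0,\infty)$ such that, for every $f\in\Lambda_a(\mathbb R^n)$, $gf\in\Lambda_a(\mathbb R^n)$ and $\|gf\|_{\Lambda_a(\mathbb R^n)}\le K\|f\|_{\Lambda_a(\mathbb R^n)}$. *Local Orlicz–Campanato space.* For $p\in(0,1)$ let $\Phi_p(\tau):=\tau/(1+\tau^{1-p})$,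 $\tau\in[0,\infty)$, and $$\|f\|_{L^{\Phi_p}(\mathbb R^n)}:=\inf\Big\{\lambda\in(0,\infty):\int_{\mathbb R^n}\Phi_p\big(|f(x)|/\lambda\big)\,dx\le1\Big\}.$$ Let $s:=\lfloor n(1/p-1)\rfloor$. For a locally integrable $g$ and a ball $B$, let $P_B^sg$ be the unique polynomial of degree at most $s$ such that $\int_B[g(x)-P_B^sg(x)]R(x)\,dx=0$ for every polynomial $R$ of degree at most $s$. Then $\mathcal L_{\rm loc}^{\Phi_p}(\mathbb R^n)$ is the set of all locally integrable functions $g$ such that $$\|g\|_{\mathcal L_{\rm loc}^{\Phi_p}(\mathbb R^n)}:=\sup_{B\text{ ball},\,|B|<1}\frac{1}{\|\mathbf 1_B\|_{L^{\Phi_p}(\mathbb R^n)}}\int_B|g(x)-P_B^sg(x)|\,dx+\sup_{B\text{ ball},\,|B|\ge1}\frac{1}{\|\mathbf 1_B\|_{L^{\Phi_p}(\mathbb R^n)}}\int_B|g(x)|\,dx<\infty.$$ **Theorem.** Let $p\in(0,1)$ and $\alpha:=1/p-1$. There is a constant $C\in(0,\infty)$, depending only on $n$ and $p$, such that the following holds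 for every function $g:\mathbb R^n\to\mathbb C$. The function $g$ is a pointwise multiplier of $\Lambda_{n\alpha}(\mathbb R^n)$ if and only if $g\in L^\infty(\mathbb R^n)\cap\mathcal L_{\rm loc}^{\Phi_p}(\mathbb R^n)$; and in that case, for every $f\in\Lambda_{n\alpha}(\mathbb R^n)$, $$\|gf\|_{\Lambda_{n\alpha}(\mathbb R^n)}\le C\Big[\|g\|_{L^\infty(\mathbb R^n)}+\|g\|_{\mathcal L_{\rm loc}^{\Phi_p}(\mathbb R^n)}\Big]\|f\|_{\Lambda_{n\alpha}(\mathbb R^n)}.$$ -/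

import Mathlib

open MeasureTheory
open scoped ENNReal NNReal

noncomputable section

namespace PointwiseMultiplier

/-- `ℝⁿ` with its Euclidean norm and Lebesgue measure. -/
abbrev Rn (n : ℕ) : Type := EuclideanSpace ℝ (Fin n)

/-! ### Inhomogeneous Lipschitz spaces -/

/-- The (extended) norm of the inhomogeneous Lipschitz space `Λ_a(ℝⁿ)`. The infimum runs over the
continuous functions `g` that agree with `f` almost everywhere. There is at most one such `g`; if
there is none, the value is `∞`. Here `(fwdDiff h)^[k]` is the `k`-th iterate of
`D_h g (x) = g (x + h) - g x`. -/
def lipschitzENorm {n : ℕ} (a : ℝ) (f : Rn n → ℂ) : ℝ≥0∞ :=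
  ⨅ (g : Rn n → ℂ) (_ : Continuous g) (_ : f =ᵐ[volume] g),
    eLpNorm f ∞ volume +
      ⨆ (x : Rn n) (h : Rn n) (_ : h ≠ 0),
        ‖(fwdDiff h)^[⌊a⌋₊ + 1] g x‖ₑ / ENNReal.ofReal (‖h‖ ^ a)

/-- The inhomogeneous Lipschitz space `Λ_a(ℝⁿ)`. -/
def lipschitzSpace (n : ℕ) (a : ℝ) : Set (Rn n → ℂ) :=
  {f | lipschitzENorm a f < ∞}

/-- `g` is a pointwise multiplier of `Λ_a(ℝⁿ)`: there is a finite positive `C` such that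
`‖g f‖ ≤ C ‖f‖` (in particular `g f` belongs to the space) for all `f` in the space. -/
def IsLipschitzMultiplier {n : ℕ} (a : ℝ) (g : Rn n → ℂ) : Prop :=
  ∃ C : ℝ≥0, 0 < C ∧ ∀ f ∈ lipschitzSpace n a,
    lipschitzENorm a (fun x => g x * f x) ≤ C * lipschitzENorm a f

/-! ### Orlicz spaces -/

/-- The Luxemburg (quasi-)norm of the Orlicz space `L^Φ(ℝⁿ)`. -/
def luxemburgENorm {n : ℕ} (Φ : ℝ → ℝ) (f : Rn n → ℂ) : ℝ≥0∞ :=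
  ⨅ (lam : ℝ) (_ : 0 < lam) (_ : ∫⁻ x, ENNReal.ofReal (Φ (‖f x‖ / lam)) ≤ 1),
    ENNReal.ofReal lam

/-- The Orlicz function `Φ_p(τ) = τ / (1 + τ^(1-p))`, used for `τ ≥ 0`. -/
def PhiP (p : ℝ) (τ : ℝ) : ℝ := τ / (1 + τ ^ (1 - p))

/-! ### Minimizing polynomials -/

/-- The value at a point of `ℝⁿ` of a polynomial in `n` variables with complex coefficients. -/
def polyVal {n : ℕ} (P : MvPolynomial (Fin n) ℂ) (x : Rn n) : ℂ :=
  MvPolynomial.eval (fun i => ((x i : ℝ) : ℂ)) P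

/-- `P` has degree at most `d` and `g - P` is orthogonal on `B` to all polynomials of degree at
most `d`. -/
def IsMinimizingPoly {n : ℕ} (d : ℕ) (B : Set (Rn n)) (g : Rn n → ℂ)
    (P : MvPolynomial (Fin n) ℂ) : Prop :=
  P.totalDegree ≤ d ∧
    ∀ R : MvPolynomial (Fin n) ℂ, R.totalDegree ≤ d →
      ∫ x in B, (g x - polyVal P x) * polyVal R x = 0

open Classical in
/-- The minimizing polynomial `P_B^d g`. -/
def minimizingPoly {n : ℕ} (d : ℕ) (B : Set (Rn n)) (g : Rn n → ℂ) : MvPolynomial (Fin n) ℂ :=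
  if h : ∃ P, IsMinimizingPoly d B g P then h.choose else 0

theorem continuous_polyVal {n : ℕ} (P : MvPolynomial (Fin n) ℂ) : Continuous (polyVal P) := by
  unfold polyVal
  have h1 : Continuous fun y : Fin n → ℂ => MvPolynomial.eval y P := MvPolynomial.continuous_eval P
  exact h1.comp (by fun_prop)

theorem integrableOn_mul_polyVal {n : ℕ} {g : Rn n → ℂ} (hg : LocallyIntegrable g volume)
    (c : Rn n) (r : ℝ) (R : MvPolynomial (Fin n) ℂ) :
    IntegrableOn (fun x => g x * polyVal R x) (Metric.ball c r) volume := by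
  have h1 : IntegrableOn g (Metric.closedBall c r) volume :=
    hg.integrableOn_isCompact (isCompact_closedBall c r)
  exact (h1.mul_continuousOn (continuous_polyVal R).continuousOn
    (isCompact_closedBall c r)).mono_set Metric.ball_subset_closedBall

/-- A polynomial of degree at most `d` that is orthogonal on a ball to all polynomials of degree at
most `d` vanishes. -/
theorem eq_zero_of_orthogonal {n d : ℕ} {c : Rn n} {r : ℝ} (hr : 0 < r)
    {Q : MvPolynomial (Fin n) ℂ} (hQ : Q.totalDegree ≤ d)
    (h : ∀ R : MvPolynomial (Fin n) ℂ, R.totalDegree ≤ d →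
      ∫ x in Metric.ball c r, polyVal Q x * polyVal R x = 0) : Q = 0 := by
  have hconj : ∀ x, polyVal (MvPolynomial.map (starRingEnd ℂ) Q) x
      = starRingEnd ℂ (polyVal Q x) := by
    intro x
    unfold polyVal
    rw [MvPolynomial.eval_map, MvPolynomial.eval, MvPolynomial.coe_eval₂Hom,
      MvPolynomial.eval₂_comp_left]
    simp [Function.comp_def]
  have h1 := h (MvPolynomial.map (starRingEnd ℂ) Q)
    ((MvPolynomial.totalDegree_le_of_support_subset
      (MvPolynomial.support_map_subset _ _)).trans hQ)
  have h2 : ∫ x in Metric.ball c r, ‖polyVal Q x‖ ^ 2 = 0 := by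
    have : (fun x => polyVal Q x * polyVal (MvPolynomial.map (starRingEnd ℂ) Q) x)
        = fun x => ((‖polyVal Q x‖ ^ 2 : ℝ) : ℂ) := by
      funext x
      rw [hconj, Complex.mul_conj, Complex.normSq_eq_norm_sq]
    rw [this, integral_complex_ofReal] at h1
    exact_mod_cast h1
  have hcont : Continuous fun x => ‖polyVal Q x‖ ^ 2 := (continuous_polyVal Q).norm.pow 2
  have hint : IntegrableOn (fun x => ‖polyVal Q x‖ ^ 2) (Metric.ball c r) volume :=
    (hcont.continuousOn.integrableOn_compact (isCompact_closedBall c r)).mono_set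
      Metric.ball_subset_closedBall
  have h3 : (fun x => ‖polyVal Q x‖ ^ 2) =ᵐ[volume.restrict (Metric.ball c r)] fun _ => 0 :=
    (setIntegral_eq_zero_iff_of_nonneg_ae (Filter.Eventually.of_forall fun x => by positivity)
      hint).1 h2
  have h4 : ∀ x ∈ Metric.ball c r, polyVal Q x = 0 := by
    intro x hx
    have := Measure.eqOn_open_of_ae_eq h3 Metric.isOpen_ball hcont.continuousOn
      continuousOn_const hx
    simpa using this
  have hopen : IsOpen {y : Fin n → ℝ | WithLp.toLp 2 y ∈ Metric.ball c r} :=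
    Metric.isOpen_ball.preimage (PiLp.continuous_toLp 2 _)
  have hmem : (fun i => c i) ∈ {y : Fin n → ℝ | WithLp.toLp 2 y ∈ Metric.ball c r} := by
    simpa using hr
  obtain ⟨ε, hε, hsub⟩ := Metric.isOpen_iff.1 hopen _ hmem
  refine MvPolynomial.funext_set
    (fun i => (fun t : ℝ => (t : ℂ)) '' Metric.ball (c i) ε) (fun i => ?_) fun y hy => ?_
  · refine Set.Infinite.image Complex.ofReal_injective.injOn ?_
    rw [Real.ball_eq_Ioo]
    exact Set.Ioo_infinite (by linarith)
  · choose z hz hzy using fun i => hy i (Set.mem_univ i)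
    have hzb : WithLp.toLp 2 z ∈ Metric.ball c r := by
      refine hsub ?_
      rw [ball_pi _ hε]
      exact fun i _ => hz i
    have := h4 _ hzb
    unfold polyVal at this
    have hy' : y = fun i => ((z i : ℝ) : ℂ) := funext fun i => (hzy i).symm
    rw [hy', map_zero]
    exact this

/-- For a locally integrable function and a ball, the minimizing polynomial exists and is unique. -/
theorem existsUnique_isMinimizingPoly {n : ℕ} (d : ℕ) {g : Rn n → ℂ}
    (hg : LocallyIntegrable g volume) (c : Rn n) {r : ℝ} (hr : 0 < r) :
    ∃! P, IsMinimizingPoly d (Metric.ball c r) g P := by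
  have hpol : ∀ P : MvPolynomial (Fin n) ℂ, LocallyIntegrable (polyVal P) volume :=
    fun P => (continuous_polyVal P).locallyIntegrable
  let V := MvPolynomial.restrictTotalDegree (Fin n) ℂ d
  have hlin : ∀ u : Rn n → ℂ, LocallyIntegrable u volume → ∃ L : V →ₗ[ℂ] ℂ,
      ∀ R : V, L R = ∫ x in Metric.ball c r, u x * polyVal R x := by
    intro u hu
    refine ⟨{ toFun := fun R => ∫ x in Metric.ball c r, u x * polyVal R x
              map_add' := fun R S => ?_
              map_smul' := fun a R => ?_ }, fun R => rfl⟩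
    · rw [← integral_add (integrableOn_mul_polyVal hu c r R) (integrableOn_mul_polyVal hu c r S)]
      simp [polyVal, mul_add]
    · simp only [polyVal, Submodule.coe_smul, MvPolynomial.smul_eval, RingHom.id_apply, smul_eq_mul]
      rw [← integral_const_mul]
      congr 1
      funext x
      ring
  choose L hL using hlin
  let T : V →ₗ[ℂ] (V →ₗ[ℂ] ℂ) :=
    { toFun := fun P => L (polyVal P) (hpol P)
      map_add' := fun P S => by
        ext R
        rw [LinearMap.add_apply, hL, hL, hL,
          ← integral_add (integrableOn_mul_polyVal (hpol _) c r R)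
            (integrableOn_mul_polyVal (hpol _) c r R)]
        simp [polyVal, add_mul]
      map_smul' := fun a P => by
        ext R
        rw [LinearMap.smul_apply, hL, hL, RingHom.id_apply, smul_eq_mul, ← integral_const_mul]
        simp [polyVal, mul_assoc] }
  have hT : ∀ P R : V, T P R = ∫ x in Metric.ball c r, polyVal P x * polyVal R x :=
    fun P R => hL _ _ R
  have hdeg : ∀ P : V, (P : MvPolynomial (Fin n) ℂ).totalDegree ≤ d :=
    fun P => (MvPolynomial.mem_restrictTotalDegree (Fin n) d _).1 P.2
  have hfin : FiniteDimensional ℂ V := inferInstance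
  have hinj : Function.Injective T := by
    rw [← LinearMap.ker_eq_bot, LinearMap.ker_eq_bot']
    intro P hP
    refine Subtype.ext (eq_zero_of_orthogonal (c := c) hr (hdeg P) fun R hR => ?_)
    have := hT P ⟨R, (MvPolynomial.mem_restrictTotalDegree (Fin n) d _).2 hR⟩
    rw [hP] at this
    simpa using this.symm
  have hsurj : Function.Surjective T :=
    (LinearMap.injective_iff_surjective_of_finrank_eq_finrank
      (Subspace.dual_finrank_eq (K := ℂ) (V := V)).symm).1 hinj
  have hsplit : ∀ P R : MvPolynomial (Fin n) ℂ,
      ∫ x in Metric.ball c r, (g x - polyVal P x) * polyVal R x =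
        (∫ x in Metric.ball c r, g x * polyVal R x) -
          ∫ x in Metric.ball c r, polyVal P x * polyVal R x := by
    intro P R
    rw [← integral_sub (integrableOn_mul_polyVal hg c r R)
      (integrableOn_mul_polyVal (hpol P) c r R)]
    simp [sub_mul]
  obtain ⟨P, hP⟩ := hsurj (L g hg)
  refine ⟨P, ⟨hdeg P, fun R hR => ?_⟩, fun P' hP' => ?_⟩
  · have h1 := hT P ⟨R, (MvPolynomial.mem_restrictTotalDegree (Fin n) d _).2 hR⟩
    rw [hP, hL] at h1
    rw [hsplit, h1, sub_self]
  · have hP'V : P' ∈ V := (MvPolynomial.mem_restrictTotalDegree (Fin n) d _).2 hP'.1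
    have : T ⟨P', hP'V⟩ = T P := by
      rw [hP]
      ext R
      rw [hT, hL]
      have := hP'.2 R (hdeg R)
      rw [hsplit, sub_eq_zero] at this
      exact this.symm
    exact congrArg Subtype.val (hinj this)

theorem isMinimizingPoly_minimizingPoly {n : ℕ} (d : ℕ) {g : Rn n → ℂ}
    (hg : LocallyIntegrable g volume) (c : Rn n) {r : ℝ} (hr : 0 < r) :
    IsMinimizingPoly d (Metric.ball c r) g (minimizingPoly d (Metric.ball c r) g) := by
  have h := (existsUnique_isMinimizingPoly d hg c hr).exists
  unfold minimizingPoly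
  rw [dif_pos h]
  exact h.choose_spec

/-! ### Local Orlicz–Campanato spaces -/

/-- The (extended) norm of the local Orlicz–Campanato space `𝓛_loc^{Φ,1,d}(ℝⁿ)`, for a locally
integrable function `g`. -/
def campanatoENorm {n : ℕ} (Φ : ℝ → ℝ) (d : ℕ) (g : Rn n → ℂ) : ℝ≥0∞ :=
  (⨆ (c : Rn n) (r : ℝ) (_ : 0 < r) (_ : volume (Metric.ball c r) < 1),
    (∫⁻ x in Metric.ball c r, ‖g x - polyVal (minimizingPoly d (Metric.ball c r) g) x‖ₑ) /
      luxemburgENorm Φ ((Metric.ball c r).indicator fun _ => 1)) +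
  ⨆ (c : Rn n) (r : ℝ) (_ : 0 < r) (_ : 1 ≤ volume (Metric.ball c r)),
    (∫⁻ x in Metric.ball c r, ‖g x‖ₑ) /
      luxemburgENorm Φ ((Metric.ball c r).indicator fun _ => 1)

/-- The (extended) norm of `𝓛_loc^{Φ_p}(ℝⁿ)`, that is, of `𝓛_loc^{Φ_p,1,d}(ℝⁿ)` with
`d = ⌊n (1/p - 1)⌋`. -/
def campanatoPhiPENorm {n : ℕ} (p : ℝ) (g : Rn n → ℂ) : ℝ≥0∞ :=
  campanatoENorm (PhiP p) ⌊(n : ℝ) * (1 / p - 1)⌋₊ g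

/-- The local Orlicz–Campanato space `𝓛_loc^{Φ_p}(ℝⁿ)`. -/
def campanatoPhiPSpace (n : ℕ) (p : ℝ) : Set (Rn n → ℂ) :=
  {g | LocallyIntegrable g volume ∧ campanatoPhiPENorm p g < ∞}

end PointwiseMultiplier

end

noncomputable section

namespace PointwiseMultiplier

/-! ### Iterated differences -/

section Differences

variable {E : Type*} [AddCommGroup E]

/-! Put `a = n(1/p - 1)` and `M = ⌊a⌋ + 1`. The theorem rests on two facts: `L^∞ ∩ 𝓛_loc^{Φ_p}`
consists of the functions in `Λ_a`, and `Λ_a` is an algebra under pointwise multiplication.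
Sufficiency and the norm estimate follow by replacing `g` by its continuous representative and
multiplying. Necessity follows by testing the multiplier on the constant function `1`, which gives
`g ∈ Λ_a`.

The algebra property (`iterate_fwdDiff_mul_le`) comes from a Leibniz rule for differences. The mixed
terms pair a `j`-th difference of one factor with an `(M - j)`-th difference of the other.
Marchaud's inequality, applied to bounded functions, shows that these are `O(|h|^{aj/M})` and
`O(|h|^{a(M-j)/M})`, so their product is `O(|h|^a)`.

The Orlicz norm of the indicator of `B` is comparable to `|B|^{1/p}` when `|B| < 1` and to `|B|`
when `|B| ≥ 1`. Since `|B|^{1/p}` is a constant times `r^a |B|`, the small-ball condition says that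
the mean oscillation about polynomials of degree below `M` is `O(r^a)`. The large-ball condition
holds for every bounded measurable function.

From Lipschitz to Campanato, the tool is Whitney's theorem (`whitney`): a function with small `M`-th
differences on a ball is uniformly close there to a polynomial of degree below `M`. Its proof
averages the difference over its endpoint, uses Stone–Weierstrass to approximate the averages by
polynomials of a fixed high degree, and lowers the degree by a finite-dimensional argument.

From Campanato to Lipschitz (`exists_lipschitz_of_campanato`), the minimizing polynomials on
shrinking balls telescope to the function at almost every point. The function is therefore within
`O(r^a)` of one polynomial near the centre of each small ball. This produces a continuous
representative, and `M`-th differences annihilate the polynomial. Differences with large step are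
controlled by the `L^∞` norm. -/

theorem norm_iterate_fwdDiff_le_of_line {k : ℕ} {u : E → ℂ} {h x : E} {K : ℝ}
    (hu : ∀ i ≤ k, ‖u (x + i • h)‖ ≤ K) : ‖(fwdDiff h)^[k] u x‖ ≤ 2 ^ k * K := by
  rw [fwdDiff_iter_eq_sum_shift]
  calc _ ≤ ∑ i ∈ Finset.range (k + 1), (k.choose i : ℝ) * K := by
        refine norm_sum_le_of_le _ fun i hi => ?_
        rw [zsmul_eq_mul, norm_mul]
        push_cast
        rw [norm_mul, norm_pow, norm_neg, norm_one, one_pow, one_mul, Complex.norm_natCast]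
        exact mul_le_mul_of_nonneg_left (hu i (by simpa [Nat.lt_succ_iff] using hi))
          (Nat.cast_nonneg _)
    _ = 2 ^ k * K := by
        rw [← Finset.sum_mul]
        congr 1
        exact_mod_cast Nat.sum_range_choose k

theorem norm_iterate_fwdDiff_le {k : ℕ} {u : E → ℂ} {K : ℝ} (hu : ∀ x, ‖u x‖ ≤ K) (h x : E) :
    ‖(fwdDiff h)^[k] u x‖ ≤ 2 ^ k * K :=
  norm_iterate_fwdDiff_le_of_line fun _ _ => hu _

theorem iterate_fwdDiff_comp_add (k : ℕ) (u : E → ℂ) (h v : E) :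
    (fwdDiff h)^[k] (fun x => u (x + v)) = fun x => (fwdDiff h)^[k] u (x + v) :=
  funext fun x => fwdDiff_iter_comp_add h u v k x

/-- A discrete Leibniz rule: each application of `D(fg) = Df · g(· + h) + f · Dg` doubles the number
of terms. The hypothesis allows independent points `x`, `y`, so the shifts need no bookkeeping. -/
theorem norm_iterate_fwdDiff_mul_le {h : E} {K : ℝ} (M : ℕ) (f g : E → ℂ)
    (hfg : ∀ j ≤ M, ∀ x y, ‖(fwdDiff h)^[j] f x‖ * ‖(fwdDiff h)^[M - j] g y‖ ≤ K) (x : E) :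
    ‖(fwdDiff h)^[M] (fun y => f y * g y) x‖ ≤ 2 ^ M * K := by
  induction M generalizing f g with
  | zero => simpa using hfg 0 le_rfl x x
  | succ M ih =>
    have hD : fwdDiff h (fun y => f y * g y)
        = (fun y => fwdDiff h f y * g (y + h)) + fun y => f y * fwdDiff h g y := by
      funext y
      simp only [fwdDiff, Pi.add_apply]
      ring
    rw [Function.iterate_succ_apply, hD, fwdDiff_iter_add, Pi.add_apply]
    have h1 := ih (fwdDiff h f) (fun y => g (y + h)) fun j hj x y => by
      rw [iterate_fwdDiff_comp_add, ← Function.iterate_succ_apply]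
      have := hfg (j + 1) (by omega) x (y + h)
      rwa [show M + 1 - (j + 1) = M - j by omega] at this
    have h2 := ih f (fwdDiff h g) fun j hj x y => by
      rw [← Function.iterate_succ_apply]
      have := hfg j (by omega) x y
      rwa [show M + 1 - j = (M - j).succ by omega] at this
    refine (norm_add_le _ _).trans ((add_le_add h1 h2).trans (le_of_eq ?_))
    ring

/-- The difference with step `2h` is the difference with step `h` plus its translate, so its `k`-th
iterate is a sum of `2^k` translates of the `k`-th difference with step `h`. -/
theorem norm_iterate_fwdDiff_two_nsmul_le {h : E} {K : ℝ} (k : ℕ) (u : E → ℂ)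
    (hu : ∀ x, ‖(fwdDiff h)^[k] u x‖ ≤ K) (x : E) :
    ‖(fwdDiff (2 • h))^[k] u x‖ ≤ 2 ^ k * K := by
  induction k generalizing u K with
  | zero => simpa using hu x
  | succ k ih =>
    have hD : fwdDiff (2 • h) u = (fun y => fwdDiff h u (y + h)) + fwdDiff h u := by
      funext y
      simp only [fwdDiff, Pi.add_apply, two_nsmul, add_assoc]
      abel
    rw [Function.iterate_succ_apply]
    have := ih (K := 2 * K) (fwdDiff (2 • h) u) fun y => by
      rw [hD, fwdDiff_iter_add, Pi.add_apply, iterate_fwdDiff_comp_add]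
      simp only [← Function.iterate_succ_apply]
      refine (norm_add_le _ _).trans ?_
      linarith [hu y, hu (y + h)]
    calc _ ≤ 2 ^ k * (2 * K) := this
      _ = _ := by ring

/-- With `T` the shift by `h`, `(T² - 1)^k - 2^k (T - 1)^k = (T - 1)^k ((T + 1)^k - 2^k)`, and the
last factor is divisible by `T - 1`. The error therefore involves only differences of order `k + 1`.
The induction uses `T² - 1 = (T - 1)² + 2(T - 1)`. -/
theorem norm_iterate_fwdDiff_two_nsmul_sub_le {h : E} {K : ℝ} (k : ℕ) (u : E → ℂ)
    (hu : ∀ x, ‖(fwdDiff h)^[k + 1] u x‖ ≤ K) (x : E) :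
    ‖(fwdDiff (2 • h))^[k] u x - 2 ^ k * (fwdDiff h)^[k] u x‖ ≤ k * 2 ^ k * K := by
  induction k generalizing u K with
  | zero => simp
  | succ k ih =>
    have hD : fwdDiff (2 • h) u = fwdDiff h (fwdDiff h u) + (2 : ℂ) • fwdDiff h u := by
      funext y
      simp only [fwdDiff, Pi.add_apply, two_nsmul, add_assoc, Pi.smul_apply, smul_eq_mul]
      ring
    have h1 := ih (u := fwdDiff h u) (fun y => by rw [← Function.iterate_succ_apply]; exact hu y)
    have h2 := norm_iterate_fwdDiff_two_nsmul_le (h := h) (K := K) k (fwdDiff h (fwdDiff h u))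
      (fun y => by
        rw [← Function.iterate_succ_apply, ← Function.iterate_succ_apply]; exact hu y) x
    have hK : 0 ≤ K := (norm_nonneg _).trans (hu x)
    rw [Function.iterate_succ_apply, Function.iterate_succ_apply, hD, fwdDiff_iter_add,
      fwdDiff_iter_const_smul]
    simp only [Pi.add_apply, Pi.smul_apply, smul_eq_mul]
    calc _ = ‖(fwdDiff (2 • h))^[k] (fwdDiff h (fwdDiff h u)) x
            + 2 * ((fwdDiff (2 • h))^[k] (fwdDiff h u) x
              - 2 ^ k * (fwdDiff h)^[k] (fwdDiff h u) x)‖ := by congr 1; ring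
      _ ≤ 2 ^ k * K + 2 * (k * 2 ^ k * K) := by
          refine (norm_add_le _ _).trans (add_le_add h2 ?_)
          rw [norm_mul, Complex.norm_ofNat]
          gcongr
      _ ≤ _ := by
          push_cast
          have : 0 ≤ 2 ^ k * K := by positivity
          ring_nf
          ring_nf at this
          linarith

end Differences

/-! ### Marchaud's inequality and the algebra property -/

section Marchaud

variable {E : Type*} [NormedAddCommGroup E] [NormedSpace ℝ E]

/-- One step of Marchaud's inequality. -/
theorem marchaud_step {k : ℕ} (hkpos : 0 < k) {b : ℝ} (hk : b < k) :
    ∃ C : ℝ, 0 < C ∧ ∀ (u : E → ℂ) (L K : ℝ), (∀ x, ‖u x‖ ≤ L) →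
      (∀ h x, ‖(fwdDiff h)^[k + 1] u x‖ ≤ K * ‖h‖ ^ b) →
      ∀ h x, ‖(fwdDiff h)^[k] u x‖ ≤ C * K * ‖h‖ ^ b := by
  have hθ0 : (0 : ℝ) < 2 ^ (b - k) := by positivity
  have hθ1 : (2 : ℝ) ^ (b - k) < 1 := Real.rpow_lt_one_of_one_lt_of_neg (by norm_num) (by linarith)
  set θ : ℝ := 2 ^ (b - k) with hθ
  refine ⟨k / (1 - θ) + 1, by have := sub_pos.2 hθ1; positivity, fun u L K hL hK h x => ?_⟩
  -- Doubling the step `i` times gives a geometric sum of ratio `2^(b - k) < 1` and a remainder that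
  -- only uses the bound `L` on `u`. The remainder tends to zero, so `L` disappears from the final
  -- estimate.
  have hs : ∀ (i : ℕ) (h : E), (∀ x, ‖(fwdDiff h)^[k] u x‖ ≤
      (∑ j ∈ Finset.range i, θ ^ j) * (k * (K * ‖h‖ ^ b)) + (2 ^ i)⁻¹ ^ k * (2 ^ k * L)) := by
    intro i
    induction i with
    | zero => intro h x; simpa using norm_iterate_fwdDiff_le hL h x
    | succ i ih =>
      intro h x
      have h1 := norm_iterate_fwdDiff_two_nsmul_sub_le k u (hK h) x
      have h2 := ih (2 • h) x
      have hnorm : ‖(2 • h : E)‖ ^ b = 2 ^ k * θ * ‖h‖ ^ b := by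
        rw [two_nsmul, ← two_smul ℝ h, norm_smul, Real.mul_rpow (by positivity) (by positivity), hθ,
          Real.rpow_sub (by norm_num), Real.rpow_natCast]
        simp only [Real.norm_ofNat]
        field_simp
      have h3 : (2 : ℝ) ^ k * ‖(fwdDiff h)^[k] u x‖ ≤
          ‖(fwdDiff (2 • h))^[k] u x‖ + k * 2 ^ k * (K * ‖h‖ ^ b) := by
        have : (2 : ℝ) ^ k * ‖(fwdDiff h)^[k] u x‖ = ‖(2 : ℂ) ^ k * (fwdDiff h)^[k] u x‖ := by
          simp
        rw [this]
        have := norm_sub_norm_le ((2 : ℂ) ^ k * (fwdDiff h)^[k] u x) ((fwdDiff (2 • h))^[k] u x)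
        rw [norm_sub_rev] at this
        linarith
      rw [hnorm] at h2
      have h4 := h3.trans (add_le_add_left h2 _)
      have h2k : (0 : ℝ) < 2 ^ k := by positivity
      rw [← le_div_iff₀' h2k] at h4
      refine h4.trans (le_of_eq ?_)
      rw [Finset.sum_range_succ', Finset.sum_congr rfl fun j _ => pow_succ θ j, ← Finset.sum_mul,
        pow_succ 2 i, mul_inv, mul_pow, inv_pow 2 k]
      field_simp
      ring
  have hK0 : 0 ≤ K * ‖h‖ ^ b := (norm_nonneg _).trans (hK h x)
  have hgeom : ∀ i : ℕ, ∑ j ∈ Finset.range i, θ ^ j ≤ 1 / (1 - θ) := fun i => by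
    rw [one_div]
    exact (summable_geometric_of_lt_one hθ0.le hθ1).sum_le_tsum _ (fun j _ => by positivity)
      |>.trans_eq (tsum_geometric_of_lt_one hθ0.le hθ1)
  have htend : Filter.Tendsto (fun i : ℕ => 1 / (1 - θ) * (k * (K * ‖h‖ ^ b)) +
      ((2 : ℝ) ^ i)⁻¹ ^ k * (2 ^ k * L)) Filter.atTop
      (nhds (1 / (1 - θ) * (k * (K * ‖h‖ ^ b)) + 0 ^ k * (2 ^ k * L))) := by
    refine tendsto_const_nhds.add ((Filter.Tendsto.pow ?_ k).mul_const _)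
    simp_rw [← inv_pow]
    exact tendsto_pow_atTop_nhds_zero_of_lt_one (by norm_num) (by norm_num)
  rw [zero_pow hkpos.ne', zero_mul, add_zero] at htend
  have hfin := ge_of_tendsto' htend fun i => (hs i h x).trans
    (add_le_add_left (mul_le_mul_of_nonneg_right (hgeom i) (by positivity)) _)
  refine hfin.trans ?_
  rw [mul_assoc, add_mul, one_mul]
  refine le_trans (le_of_eq ?_) (le_add_of_nonneg_right hK0)
  ring

/-- Marchaud's inequality for powers. -/
theorem marchaud {k : ℕ} (hkpos : 0 < k) {b : ℝ} (hk : b < k) (m : ℕ) :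
    ∃ C : ℝ, 0 < C ∧ ∀ (u : E → ℂ) (L K : ℝ), (∀ x, ‖u x‖ ≤ L) →
      (∀ h x, ‖(fwdDiff h)^[k + m] u x‖ ≤ K * ‖h‖ ^ b) →
      ∀ h x, ‖(fwdDiff h)^[k] u x‖ ≤ C * K * ‖h‖ ^ b := by
  induction m with
  | zero => exact ⟨1, one_pos, fun u L K _ hK h x => by simpa using hK h x⟩
  | succ m ih =>
    obtain ⟨C, hC, H⟩ := ih
    obtain ⟨C', hC', H'⟩ := marchaud_step (E := E) (k := k + m) (by omega) (b := b)
      (by push_cast; linarith [(Nat.cast_nonneg m : (0 : ℝ) ≤ m)])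
    refine ⟨C * C', by positivity, fun u L K hL hK h x => ?_⟩
    have := H u L (C' * K) hL (fun h x => H' u L K hL hK h x) h x
    rwa [← mul_assoc] at this

/-- Marchaud's inequality lowers the order from `M` to `j` for exponents below `j`, and `b = aj/M`
is such an exponent because `a < M`. Since `b ≤ a`, the hypothesis at order `M` weakens to exponent
`b`: directly when `‖h‖ ≤ 1`, and from the bound on `u` when `‖h‖ ≥ 1`. -/
theorem interpolate_iterate_fwdDiff {M : ℕ} {a : ℝ} (ha : 0 < a) (haM : a < M) :
    ∃ C : ℝ, 0 < C ∧ ∀ (u : E → ℂ) (A : ℝ), (∀ x, ‖u x‖ ≤ A) →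
      (∀ h x, ‖(fwdDiff h)^[M] u x‖ ≤ A * ‖h‖ ^ a) →
      ∀ j ≤ M, ∀ h x, ‖(fwdDiff h)^[j] u x‖ ≤ C * A * ‖h‖ ^ (a * j / M) := by
  have hM : (0 : ℝ) < M := ha.trans haM
  have key : ∀ j : ℕ, ∃ C : ℝ, 0 < C ∧ (j ≤ M → ∀ (u : E → ℂ) (A : ℝ), (∀ x, ‖u x‖ ≤ A) →
      (∀ h x, ‖(fwdDiff h)^[M] u x‖ ≤ A * ‖h‖ ^ a) →
      ∀ h x, ‖(fwdDiff h)^[j] u x‖ ≤ C * A * ‖h‖ ^ (a * j / M)) := by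
    intro j
    rcases Nat.eq_zero_or_pos j with rfl | hj
    · exact ⟨1, one_pos, fun _ u A hA _ h x => by simpa using hA x⟩
    by_cases hjM : j ≤ M
    swap
    · exact ⟨1, one_pos, fun h => absurd h hjM⟩
    have hj' : (0 : ℝ) < j := by exact_mod_cast hj
    have hbj : a * j / M < j := by
      rw [div_lt_iff₀ hM, mul_comm]
      exact mul_lt_mul_of_pos_left haM hj'
    have hba : a * j / M ≤ a := by
      rw [div_le_iff₀ hM]
      exact mul_le_mul_of_nonneg_left (by exact_mod_cast hjM) ha.le
    obtain ⟨m, rfl⟩ := Nat.exists_eq_add_of_le hjM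
    obtain ⟨C, hC, H⟩ := marchaud (E := E) hj hbj m
    refine ⟨C * 2 ^ (j + m), by positivity, fun _ u A hA hD h x => ?_⟩
    have hA0 : 0 ≤ A := (norm_nonneg _).trans (hA x)
    have := H u A (2 ^ (j + m) * A) hA (fun h x => ?_) h x
    · rwa [← mul_assoc] at this
    rcases le_total 1 ‖h‖ with h1 | h1
    · refine (norm_iterate_fwdDiff_le hA h x).trans (le_mul_of_one_le_right (by positivity) ?_)
      exact Real.one_le_rpow h1 (by positivity)
    · refine (hD h x).trans ?_
      have h2 : A ≤ 2 ^ (j + m) * A :=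
        le_mul_of_one_le_left hA0 (one_le_pow₀ (by norm_num))
      refine mul_le_mul h2 ?_ (by positivity) (by positivity)
      rcases (norm_nonneg h).eq_or_lt with h0 | h0
      · rw [← h0, Real.zero_rpow ha.ne', Real.zero_rpow (by positivity)]
      · exact Real.rpow_le_rpow_of_exponent_ge h0 h1 hba
  choose C hC H using key
  refine ⟨∑ j ∈ Finset.range (M + 1), C j, Finset.sum_pos (fun j _ => hC j) (by simp),
    fun u A hA hD j hj h x => (H j hj u A hA hD h x).trans ?_⟩
  have hA0 : 0 ≤ A := (norm_nonneg _).trans (hA x)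
  gcongr
  exact Finset.single_le_sum (f := C) (fun i _ => (hC i).le) (Finset.mem_range.2 (by omega))

/-- Bounded functions whose `M`-th differences are `O(|h|^a)` form an algebra. -/
theorem iterate_fwdDiff_mul_le {M : ℕ} {a : ℝ} (ha : 0 < a) (haM : a < M) :
    ∃ C : ℝ, 0 < C ∧ ∀ (f g : E → ℂ) (A A' : ℝ), (∀ x, ‖f x‖ ≤ A) → (∀ x, ‖g x‖ ≤ A') →
      (∀ h x, ‖(fwdDiff h)^[M] f x‖ ≤ A * ‖h‖ ^ a) →
      (∀ h x, ‖(fwdDiff h)^[M] g x‖ ≤ A' * ‖h‖ ^ a) →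
      ∀ h x, ‖(fwdDiff h)^[M] (fun y => f y * g y) x‖ ≤ C * A * A' * ‖h‖ ^ a := by
  obtain ⟨C, hC, H⟩ := interpolate_iterate_fwdDiff (E := E) ha haM
  have hM : (0 : ℝ) < M := ha.trans haM
  refine ⟨2 ^ M * C * C, by positivity, fun f g A A' hf hg hDf hDg h x => ?_⟩
  have hA : 0 ≤ A := (norm_nonneg _).trans (hf x)
  have hA' : 0 ≤ A' := (norm_nonneg _).trans (hg x)
  have := norm_iterate_fwdDiff_mul_le (h := h) (K := C * C * A * A' * ‖h‖ ^ a) M f g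
    (fun j hj x y => ?_) x
  · calc _ ≤ _ := this
      _ = _ := by ring
  -- The interpolated exponents `aj/M` and `a(M - j)/M` add up to `a`.
  · calc _ ≤ (C * A * ‖h‖ ^ (a * j / M)) * (C * A' * ‖h‖ ^ (a * (M - j : ℕ) / M)) :=
          mul_le_mul (H f A hf hDf j hj h x) (H g A' hg hDg (M - j) (by omega) h y)
            (norm_nonneg _) (by positivity)
      _ = C * C * A * A' * (‖h‖ ^ (a * j / M) * ‖h‖ ^ (a * (M - j : ℕ) / M)) := by ring
      _ = _ := by
        rw [← Real.rpow_add_of_nonneg (norm_nonneg h) (by positivity) (by positivity),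
          Nat.cast_sub hj]
        congr 2
        field_simp
        ring

end Marchaud

/-! ### Lipschitz norms in terms of real bounds -/

theorem norm_le_of_ae_norm_le {n : ℕ} {g : Rn n → ℂ} (hg : Continuous g) {A : ℝ}
    (h : ∀ᵐ x, ‖g x‖ ≤ A) (x : Rn n) : ‖g x‖ ≤ A := by
  have hcl : IsClosed {x | ‖g x‖ ≤ A} := isClosed_le hg.norm continuous_const
  have hd : Dense {x | ‖g x‖ ≤ A} := Measure.dense_of_ae h
  have := hcl.closure_eq ▸ hd.closure_eq
  exact (Set.eq_univ_iff_forall.1 this) x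

theorem ae_norm_le_toReal_eLpNorm_top {n : ℕ} {g : Rn n → ℂ} (hg : eLpNorm g ∞ volume ≠ ∞) :
    ∀ᵐ x, ‖g x‖ ≤ (eLpNorm g ∞ volume).toReal := by
  rw [eLpNorm_exponent_top] at hg ⊢
  filter_upwards [ae_le_eLpNormEssSup (f := g) (μ := volume)] with x hx
  rw [← toReal_enorm]
  exact ENNReal.toReal_mono hg hx

theorem iterate_fwdDiff_zero_step {n k : ℕ} (hk : 0 < k) (g : Rn n → ℂ) (x : Rn n) :
    (fwdDiff (0 : Rn n))^[k] g x = 0 := by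
  obtain ⟨k, rfl⟩ := Nat.exists_eq_succ_of_ne_zero hk.ne'
  rw [Function.iterate_succ_apply']
  simp [fwdDiff]

/-- A function of finite Lipschitz norm agrees almost everywhere with a continuous function that
satisfies the Lipschitz bounds with the norm as constant. -/
theorem exists_continuous_of_lipschitzENorm_lt_top {n : ℕ} {a : ℝ} {f : Rn n → ℂ}
    (hf : lipschitzENorm a f < ∞) :
    ∃ u : Rn n → ℂ, Continuous u ∧ f =ᵐ[volume] u ∧
      (∀ x, ‖u x‖ ≤ (lipschitzENorm a f).toReal) ∧
      ∀ h x, ‖(fwdDiff h)^[⌊a⌋₊ + 1] u x‖ ≤ (lipschitzENorm a f).toReal * ‖h‖ ^ a := by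
  have hf' := hf
  unfold lipschitzENorm at hf'
  simp only [iInf_lt_iff] at hf'
  obtain ⟨u, hu, hfu, -⟩ := hf'
  -- Continuous functions that agree almost everywhere are equal, so the infimum defining the norm
  -- is attained at the only admissible representative.
  have hval : lipschitzENorm a f = eLpNorm f ∞ volume +
      ⨆ (x : Rn n) (h : Rn n) (_ : h ≠ 0),
        ‖(fwdDiff h)^[⌊a⌋₊ + 1] u x‖ₑ / ENNReal.ofReal (‖h‖ ^ a) := by
    refine le_antisymm (iInf_le_of_le u (iInf_le_of_le hu (iInf_le_of_le hfu le_rfl))) ?_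
    refine le_iInf fun v => le_iInf fun hv => le_iInf fun hfv => ?_
    have : u = v := (hu.ae_eq_iff_eq volume hv).1 (hfu.symm.trans hfv)
    rw [this]
  refine ⟨u, hu, hfu, fun x => norm_le_of_ae_norm_le hu ?_ x, fun h x => ?_⟩
  · have h1 : eLpNorm f ∞ volume ≤ lipschitzENorm a f := hval ▸ le_self_add
    filter_upwards [hfu, ae_norm_le_toReal_eLpNorm_top (h1.trans_lt hf).ne] with x hx hx'
    rw [← hx]
    exact hx'.trans (ENNReal.toReal_mono hf.ne h1)
  · by_cases hh : h = 0
    · subst hh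
      rw [iterate_fwdDiff_zero_step (Nat.succ_pos _), norm_zero]
      positivity
    have h1 : ‖(fwdDiff h)^[⌊a⌋₊ + 1] u x‖ₑ / ENNReal.ofReal (‖h‖ ^ a) ≤ lipschitzENorm a f := by
      rw [hval]
      refine le_trans ?_ le_add_self
      exact le_iSup_of_le x (le_iSup_of_le h (le_iSup_of_le hh le_rfl))
    have hpos : 0 < ‖h‖ ^ a := Real.rpow_pos_of_pos (norm_pos_iff.2 hh) a
    rw [ENNReal.div_le_iff_le_mul (Or.inl (by simpa using hpos)) (Or.inl ENNReal.ofReal_ne_top)]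
      at h1
    have h2 := ENNReal.toReal_mono (ENNReal.mul_ne_top hf.ne ENNReal.ofReal_ne_top) h1
    rwa [toReal_enorm, ENNReal.toReal_mul, ENNReal.toReal_ofReal hpos.le] at h2

theorem lipschitzENorm_le_of_bounds {n : ℕ} {a : ℝ} {f u : Rn n → ℂ} (hu : Continuous u)
    (hfu : f =ᵐ[volume] u) {A A' : ℝ} (hA : ∀ᵐ x, ‖f x‖ ≤ A)
    (hD : ∀ h x, ‖(fwdDiff h)^[⌊a⌋₊ + 1] u x‖ ≤ A' * ‖h‖ ^ a) :
    lipschitzENorm a f ≤ ENNReal.ofReal A + ENNReal.ofReal A' := by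
  refine iInf_le_of_le u (iInf_le_of_le hu (iInf_le_of_le hfu (add_le_add ?_ ?_)))
  · rw [eLpNorm_exponent_top]
    refine eLpNormEssSup_le_of_ae_enorm_bound ?_
    filter_upwards [hA] with x hx
    rw [← ofReal_norm]
    exact ENNReal.ofReal_le_ofReal hx
  · refine iSup_le fun x => iSup_le fun h => iSup_le fun hh => ?_
    have hpos : 0 < ‖h‖ ^ a := Real.rpow_pos_of_pos (norm_pos_iff.2 hh) a
    rw [ENNReal.div_le_iff_le_mul (Or.inl (by simpa using hpos)) (Or.inl ENNReal.ofReal_ne_top),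
      ← ENNReal.ofReal_mul' hpos.le, ← ofReal_norm]
    exact ENNReal.ofReal_le_ofReal (hD h x)

/-! ### The Orlicz norm of the indicator of a ball -/

theorem luxemburgENorm_indicator {n : ℕ} {p : ℝ} {B : Set (Rn n)}
    (hB : MeasurableSet B) :
    luxemburgENorm (PhiP p) (B.indicator fun _ => 1) =
      ⨅ (lam : ℝ) (_ : 0 < lam) (_ : ENNReal.ofReal (PhiP p (1 / lam)) * volume B ≤ 1),
        ENNReal.ofReal lam := by
  unfold luxemburgENorm
  have hx : ∀ (lam : ℝ) (x : Rn n), ENNReal.ofReal (PhiP p (‖B.indicator (fun _ => (1 : ℂ)) x‖ / lam))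
      = B.indicator (fun _ => ENNReal.ofReal (PhiP p (1 / lam))) x := fun lam x => by
    by_cases hx : x ∈ B <;> simp [hx, PhiP]
  simp only [hx, lintegral_indicator hB, setLIntegral_const]

/-- Since `Φ_p(τ) ≤ τ^p`, the value `λ = v^(1/p)` is admissible in the Luxemburg infimum. -/
theorem luxemburgENorm_indicator_le {n : ℕ} {p : ℝ} (hp0 : 0 < p) (hp1 : p < 1) {B : Set (Rn n)}
    (hB : MeasurableSet B) {v : ℝ} (hv : 0 < v) (hBv : volume B = ENNReal.ofReal v) :
    luxemburgENorm (PhiP p) (B.indicator fun _ => 1) ≤ ENNReal.ofReal (v ^ (1 / p)) := by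
  rw [luxemburgENorm_indicator hB]
  have hl : 0 < v ^ (1 / p) := by positivity
  refine iInf_le_of_le (v ^ (1 / p)) (iInf_le_of_le hl (iInf_le_of_le ?_ le_rfl))
  rw [hBv, ← ENNReal.ofReal_mul' hv.le, ← ENNReal.ofReal_one]
  refine ENNReal.ofReal_le_ofReal ?_
  set t : ℝ := 1 / v ^ (1 / p) with ht
  have ht0 : 0 < t := by positivity
  have htp : t ^ p = 1 / v := by
    rw [ht, Real.div_rpow zero_le_one hl.le, Real.one_rpow, ← Real.rpow_mul hv.le,
      one_div_mul_cancel hp0.ne', Real.rpow_one]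
  have h1 : PhiP p t ≤ t ^ p := by
    unfold PhiP
    rw [div_le_iff₀ (by positivity)]
    calc t = t ^ p * t ^ (1 - p) := by rw [← Real.rpow_add ht0]; simp
      _ ≤ t ^ p * (1 + t ^ (1 - p)) := by gcongr; linarith
  calc PhiP p t * v ≤ 1 / v * v := by rw [← htp]; gcongr
    _ = 1 := by field_simp

/-- Lower bounds for the norm of an indicator, uniform over sets of measure `v`. -/
theorem le_luxemburgENorm_indicator {n : ℕ} {p : ℝ} (hp0 : 0 < p) (hp1 : p < 1) {B : Set (Rn n)}
    (hB : MeasurableSet B) {v : ℝ} (hv : 0 < v) (hBv : volume B = ENNReal.ofReal v) :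
    ENNReal.ofReal (min ((v / 2) ^ (1 / p)) (v / 2)) ≤
      luxemburgENorm (PhiP p) (B.indicator fun _ => 1) := by
  rw [luxemburgENorm_indicator hB]
  refine le_iInf fun lam => le_iInf fun hlam => le_iInf fun h => ENNReal.ofReal_le_ofReal ?_
  rw [hBv, ← ENNReal.ofReal_mul' hv.le, ← ENNReal.ofReal_one,
    ENNReal.ofReal_le_ofReal_iff zero_le_one] at h
  have hq : 0 < 1 - p := by linarith
  unfold PhiP at h
  have hpow : 0 < (1 / lam) ^ (1 - p) := by positivity
  rw [div_mul_eq_mul_div, div_le_one (by positivity)] at h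
  -- The larger of the two terms in `1 + (1/λ)^(1-p)` depends on whether `λ ≤ 1`. Bounding the sum
  -- by twice that term produces the halves in the statement.
  rcases le_total lam 1 with h1 | h1
  · refine (min_le_left _ _).trans ?_
    have h2 : 1 ≤ (1 / lam) ^ (1 - p) := Real.one_le_rpow (by rw [le_div_iff₀ hlam]; linarith) hq.le
    have h3 : (1 / lam) ^ (1 - p) * lam = lam ^ p := by
      rw [Real.div_rpow zero_le_one hlam.le, Real.one_rpow, Real.rpow_sub hlam, Real.rpow_one]
      field_simp
    have h4 : v / 2 ≤ lam ^ p := by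
      rw [← h3]
      have : 1 / lam * v ≤ 2 * (1 / lam) ^ (1 - p) := by linarith
      rw [div_mul_eq_mul_div, one_mul, div_le_iff₀ hlam] at this
      linarith
    calc (v / 2) ^ (1 / p) ≤ (lam ^ p) ^ (1 / p) := by gcongr
      _ = lam := by rw [← Real.rpow_mul hlam.le, mul_one_div_cancel hp0.ne', Real.rpow_one]
  · refine (min_le_right _ _).trans ?_
    have h2 : (1 / lam) ^ (1 - p) ≤ 1 :=
      Real.rpow_le_one (by positivity) (by rw [div_le_iff₀ hlam]; linarith) hq.le
    have : 1 / lam * v ≤ 2 := by linarith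
    rw [div_mul_eq_mul_div, one_mul, div_le_iff₀ hlam] at this
    linarith

/-! ### Polynomials on balls -/

theorem totalDegree_bind₁_le {σ τ R : Type*} [CommSemiring R] {f : σ → MvPolynomial τ R}
    (hf : ∀ i, (f i).totalDegree ≤ 1) (P : MvPolynomial σ R) :
    (MvPolynomial.bind₁ f P).totalDegree ≤ P.totalDegree := by
  conv_lhs => rw [P.as_sum, map_sum]
  refine MvPolynomial.totalDegree_finsetSum_le fun m hm => ?_
  rw [MvPolynomial.bind₁_monomial]
  refine (MvPolynomial.totalDegree_mul _ _).trans ?_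
  rw [MvPolynomial.totalDegree_C, zero_add]
  refine (MvPolynomial.totalDegree_finsetProd _ _).trans ?_
  refine le_trans (Finset.sum_le_sum fun i _ => ?_) (MvPolynomial.le_totalDegree hm)
  refine (MvPolynomial.totalDegree_pow _ _).trans ?_
  simpa using Nat.mul_le_mul_left (m i) (hf i)

theorem exists_polyVal_affine {n : ℕ} (P : MvPolynomial (Fin n) ℂ) (c : Rn n) (r : ℝ) :
    ∃ Q : MvPolynomial (Fin n) ℂ, Q.totalDegree ≤ P.totalDegree ∧
      ∀ x, polyVal Q x = polyVal P (c + r • x) := by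
  refine ⟨MvPolynomial.bind₁ (fun i => MvPolynomial.C (c i : ℂ) +
    MvPolynomial.C (r : ℂ) * MvPolynomial.X i) P, totalDegree_bind₁_le (fun i => ?_) P, fun x => ?_⟩
  · refine (MvPolynomial.totalDegree_add _ _).trans (max_le (by simp) ?_)
    refine (MvPolynomial.totalDegree_mul _ _).trans ?_
    simp
  · simp only [polyVal]
    rw [MvPolynomial.eval, MvPolynomial.eval₂Hom_bind₁]
    congr 2
    funext i
    simp

theorem polyVal_add {n : ℕ} (P Q : MvPolynomial (Fin n) ℂ) (x : Rn n) :
    polyVal (P + Q) x = polyVal P x + polyVal Q x := map_add _ _ _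

theorem polyVal_sub {n : ℕ} (P Q : MvPolynomial (Fin n) ℂ) (x : Rn n) :
    polyVal (P - Q) x = polyVal P x - polyVal Q x := map_sub _ _ _

theorem polyVal_C {n : ℕ} (z : ℂ) (x : Rn n) : polyVal (MvPolynomial.C z) x = z :=
  MvPolynomial.eval_C z

theorem totalDegree_sub_le_of_le {σ : Type*} {d : ℕ} {P Q : MvPolynomial σ ℂ}
    (hP : P.totalDegree ≤ d) (hQ : Q.totalDegree ≤ d) : (P - Q).totalDegree ≤ d :=
  (MvPolynomial.totalDegree_sub _ _).trans (max_le hP hQ)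

theorem totalDegree_add_le_of_le {σ : Type*} {d : ℕ} {P Q : MvPolynomial σ ℂ}
    (hP : P.totalDegree ≤ d) (hQ : Q.totalDegree ≤ d) : (P + Q).totalDegree ≤ d :=
  (MvPolynomial.totalDegree_add _ _).trans (max_le hP hQ)

/-- On a finite-dimensional space, the distance to the kernel of `T`, measured through `R`, is
controlled by `T`. -/
theorem exists_ker_near {V E F : Type*} [AddCommGroup V] [Module ℂ V] [FiniteDimensional ℂ V]
    [NormedAddCommGroup E] [NormedSpace ℂ E] [NormedAddCommGroup F] [NormedSpace ℂ F]
    (R : V →ₗ[ℂ] E) (T : V →ₗ[ℂ] F) :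
    ∃ C : ℝ, 0 < C ∧ ∀ v, ∃ v₀ ∈ LinearMap.ker T, ‖R (v - v₀)‖ ≤ C * ‖T v‖ := by
  -- A linear right inverse `s` of `T` onto its range gives `v₀ = v - s(Tv)`. The composite of `R`
  -- and `s` is bounded because the range is finite-dimensional.
  obtain ⟨s, hs⟩ := T.rangeRestrict.exists_rightInverse_of_surjective T.range_rangeRestrict
  let L : LinearMap.range T →L[ℂ] E := LinearMap.toContinuousLinearMap (R ∘ₗ s)
  refine ⟨‖L‖ + 1, by positivity, fun v => ⟨v - s (T.rangeRestrict v), ?_, ?_⟩⟩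
  · have h1 : T.rangeRestrict (s (T.rangeRestrict v)) = T.rangeRestrict v :=
      LinearMap.congr_fun hs _
    have h2 := congrArg Subtype.val h1
    rw [LinearMap.mem_ker, map_sub, sub_eq_zero]
    exact h2.symm
  · rw [sub_sub_cancel]
    have h1 : ‖L (T.rangeRestrict v)‖ ≤ ‖L‖ * ‖T.rangeRestrict v‖ := L.le_opNorm _
    have h2 : ‖T.rangeRestrict v‖ = ‖T v‖ := rfl
    rw [h2] at h1
    refine h1.trans ?_
    gcongr
    linarith

/-- Restriction of polynomials of degree at most `d` to a compact set. -/
def polyRestrict (n d : ℕ) (K : Set (Rn n)) :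
    MvPolynomial.restrictTotalDegree (Fin n) ℂ d →ₗ[ℂ] C(K, ℂ) where
  toFun P := ⟨fun x => polyVal P.1 x, (continuous_polyVal _).comp continuous_subtype_val⟩
  map_add' P Q := by ext x; simp [polyVal]
  map_smul' z P := by ext x; simp [polyVal]

theorem norm_polyVal_le_polyRestrict {n d : ℕ} (P : MvPolynomial.restrictTotalDegree (Fin n) ℂ d)
    {x : Rn n} (hx : x ∈ Metric.closedBall (0 : Rn n) 1) :
    ‖polyVal P.1 x‖ ≤ ‖polyRestrict n d (Metric.closedBall 0 1) P‖ :=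
  ContinuousMap.norm_coe_le_norm (polyRestrict n d (Metric.closedBall 0 1) P) ⟨x, hx⟩

/-- A polynomial of degree at most `d` is determined by its moments against a basis, so its sup norm
is controlled by them. For the minimizing polynomial these moments are those of `u`, hence bounded
by the `L¹` norm of `u`. -/
theorem norm_polyVal_le_of_isMinimizingPoly_unit (n d : ℕ) :
    ∃ C : ℝ, 0 < C ∧ ∀ (u : Rn n → ℂ) (P : MvPolynomial (Fin n) ℂ),
      IntegrableOn u (Metric.ball 0 1) → IsMinimizingPoly d (Metric.ball 0 1) u P →
      ∀ x ∈ Metric.closedBall (0 : Rn n) 1,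
        ‖polyVal P x‖ ≤ C * ∫ y in Metric.ball 0 1, ‖u y‖ := by
  set B : Set (Rn n) := Metric.ball 0 1
  let V := MvPolynomial.restrictTotalDegree (Fin n) ℂ d
  have hfin : FiniteDimensional ℂ V := inferInstance
  let b := Module.finBasis ℂ V
  have hint : ∀ P R : MvPolynomial (Fin n) ℂ,
      IntegrableOn (fun x => polyVal P x * polyVal R x) B := fun P R =>
    integrableOn_mul_polyVal (continuous_polyVal P).locallyIntegrable 0 1 R
  let T : V →ₗ[ℂ] (Fin (Module.finrank ℂ V) → ℂ) :=
    { toFun := fun P i => ∫ x in B, polyVal P.1 x * polyVal (b i).1 x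
      map_add' := fun P Q => by
        funext i
        rw [Pi.add_apply, ← integral_add (hint _ _) (hint _ _)]
        simp [polyVal, add_mul]
      map_smul' := fun z P => by
        funext i
        rw [Pi.smul_apply, RingHom.id_apply, smul_eq_mul, ← integral_const_mul]
        simp [polyVal, mul_assoc] }
  have hker : ∀ P ∈ LinearMap.ker T, P = 0 := by
    intro P hP
    refine Subtype.ext (eq_zero_of_orthogonal (c := 0) one_pos
      ((MvPolynomial.mem_restrictTotalDegree (Fin n) d _).1 P.2) fun R hR => ?_)
    have hRV : R ∈ V := (MvPolynomial.mem_restrictTotalDegree (Fin n) d _).2 hR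
    have hsum : ∀ x, polyVal R x = ∑ i, b.repr ⟨R, hRV⟩ i * polyVal (b i).1 x := by
      intro x
      have h1 := congrArg Subtype.val (b.sum_repr ⟨R, hRV⟩)
      have h2 : R = ∑ i, b.repr ⟨R, hRV⟩ i • (b i).1 := by
        rw [AddSubmonoidClass.coe_finsetSum] at h1
        exact h1.symm
      calc polyVal R x = MvPolynomial.eval (fun i => ((x i : ℝ) : ℂ))
            (∑ i, b.repr ⟨R, hRV⟩ i • (b i).1) := by rw [← h2]; rfl
        _ = _ := by simp [polyVal]
    have hsum' : ∀ x, polyVal P.1 x * polyVal R x =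
        ∑ i, b.repr ⟨R, hRV⟩ i * (polyVal P.1 x * polyVal (b i).1 x) := fun x => by
      rw [hsum, Finset.mul_sum]
      exact Finset.sum_congr rfl fun i _ => mul_left_comm _ _ _
    simp_rw [hsum']
    rw [integral_finsetSum _ fun i _ => (hint _ _).const_mul _]
    refine Finset.sum_eq_zero fun i _ => ?_
    rw [integral_const_mul]
    have h3 : T P i = 0 := by rw [LinearMap.mem_ker.1 hP]; rfl
    have h4 : ∫ x in B, polyVal P.1 x * polyVal (b i).1 x = 0 := h3
    rw [h4, mul_zero]
  obtain ⟨C, hC, H⟩ := exists_ker_near (polyRestrict n d (Metric.closedBall 0 1)) T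
  set S : ℝ := ∑ i, ‖polyRestrict n d (Metric.closedBall 0 1) (b i)‖ with hS
  refine ⟨C * (S + 1), by positivity, fun u P hu hP x hx => ?_⟩
  have hPV : P ∈ V := (MvPolynomial.mem_restrictTotalDegree (Fin n) d _).2 hP.1
  obtain ⟨P₀, hP₀, hle⟩ := H ⟨P, hPV⟩
  rw [hker P₀ hP₀, sub_zero] at hle
  refine (norm_polyVal_le_polyRestrict ⟨P, hPV⟩ hx).trans (hle.trans ?_)
  rw [mul_assoc]
  refine mul_le_mul_of_nonneg_left ?_ hC.le
  have hI : 0 ≤ ∫ y in B, ‖u y‖ := integral_nonneg fun y => norm_nonneg _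
  refine (pi_norm_le_iff_of_nonneg (by positivity)).2 fun i => ?_
  have hbi : ∀ y ∈ B, ‖polyVal (b i).1 y‖ ≤ S + 1 := fun y hy => by
    have h1 := norm_polyVal_le_polyRestrict (b i) (Metric.ball_subset_closedBall hy)
    have h2 : ‖polyRestrict n d (Metric.closedBall 0 1) (b i)‖ ≤ S :=
      Finset.single_le_sum (f := fun i => ‖polyRestrict n d (Metric.closedBall 0 1) (b i)‖)
        (fun i _ => norm_nonneg _) (Finset.mem_univ i)
    linarith
  have hui : IntegrableOn (fun y => u y * polyVal (b i).1 y) B := by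
    refine Integrable.mul_bdd (c := S + 1) hu
      (continuous_polyVal _).aestronglyMeasurable ?_
    exact (ae_restrict_iff' measurableSet_ball).2 (Filter.Eventually.of_forall hbi)
  have horth := hP.2 (b i).1 ((MvPolynomial.mem_restrictTotalDegree (Fin n) d _).1 (b i).2)
  simp_rw [sub_mul] at horth
  rw [integral_sub hui (hint _ _), sub_eq_zero] at horth
  change ‖∫ y in B, polyVal P y * polyVal (b i).1 y‖ ≤ _
  rw [← horth, ← integral_const_mul]
  refine norm_integral_le_of_norm_le (hu.norm.const_mul _) ?_
  refine (ae_restrict_iff' measurableSet_ball).2 (Filter.Eventually.of_forall fun y hy => ?_)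
  rw [norm_mul, mul_comm]
  exact mul_le_mul_of_nonneg_right (hbi y hy) (norm_nonneg _)

theorem setIntegral_ball_affine {n : ℕ} {F : Type*} [NormedAddCommGroup F] [NormedSpace ℝ F]
    (f : Rn n → F) (c : Rn n) {r : ℝ} (hr : 0 < r) :
    ∫ x in Metric.ball (0 : Rn n) 1, f (c + r • x) = (r ^ n)⁻¹ • ∫ x in Metric.ball c r, f x := by
  rw [← integral_indicator measurableSet_ball, ← integral_indicator measurableSet_ball]
  have h1 : ∀ x : Rn n, (Metric.ball (0 : Rn n) 1).indicator (fun x => f (c + r • x)) x =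
      (fun y => (Metric.ball c r).indicator f (c + y)) (r • x) := by
    intro x
    have : x ∈ Metric.ball (0 : Rn n) 1 ↔ c + r • x ∈ Metric.ball c r := by
      rw [mem_ball_zero_iff, mem_ball_iff_norm, add_sub_cancel_left, norm_smul, Real.norm_eq_abs,
        abs_of_pos hr]
      exact (mul_lt_iff_lt_one_right hr).symm
    by_cases hx : x ∈ Metric.ball (0 : Rn n) 1
    · simp [hx, this.1 hx]
    · simp [hx, mt this.2 hx]
  simp_rw [h1]
  rw [Measure.integral_comp_smul volume (fun y => (Metric.ball c r).indicator f (c + y)) r,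
    integral_add_left_eq_self]
  simp [abs_of_pos hr]

theorem integrableOn_ball_affine {n : ℕ} {u : Rn n → ℂ} {c : Rn n} {r : ℝ} (hr : 0 < r)
    (hu : IntegrableOn u (Metric.ball c r)) :
    IntegrableOn (fun x => u (c + r • x)) (Metric.ball 0 1) := by
  have h1 : Integrable ((Metric.ball c r).indicator u) :=
    (integrable_indicator_iff measurableSet_ball).2 hu
  have h2 := ((integrable_comp_smul_iff volume _ hr.ne').2 (h1.comp_add_left c))
  rw [← integrable_indicator_iff measurableSet_ball]
  refine h2.congr (Filter.Eventually.of_forall fun x => ?_)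
  have : x ∈ Metric.ball (0 : Rn n) 1 ↔ c + r • x ∈ Metric.ball c r := by
    rw [mem_ball_zero_iff, mem_ball_iff_norm, add_sub_cancel_left, norm_smul, Real.norm_eq_abs,
      abs_of_pos hr]
    exact (mul_lt_iff_lt_one_right hr).symm
  by_cases hx : x ∈ Metric.ball (0 : Rn n) 1
  · simp only [Set.indicator_of_mem hx, Set.indicator_of_mem (this.1 hx)]
  · simp only [Set.indicator_of_notMem hx, Set.indicator_of_notMem (mt this.2 hx)]

/-- The minimizing polynomial is bounded on the ball by the mean of the function. -/
theorem norm_polyVal_le_of_isMinimizingPoly (n d : ℕ) :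
    ∃ C : ℝ, 0 < C ∧ ∀ (u : Rn n → ℂ) (P : MvPolynomial (Fin n) ℂ) (c : Rn n) (r : ℝ), 0 < r →
      IntegrableOn u (Metric.ball c r) → IsMinimizingPoly d (Metric.ball c r) u P →
      ∀ x ∈ Metric.closedBall c r,
        ‖polyVal P x‖ ≤ C * ((r ^ n)⁻¹ * ∫ y in Metric.ball c r, ‖u y‖) := by
  obtain ⟨C, hC, H⟩ := norm_polyVal_le_of_isMinimizingPoly_unit n d
  refine ⟨C, hC, fun u P c r hr hu hP x hx => ?_⟩
  obtain ⟨Q, hQd, hQ⟩ := exists_polyVal_affine P c r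
  have h1 := H (fun x => u (c + r • x)) Q (integrableOn_ball_affine hr hu)
    ⟨hQd.trans hP.1, fun R hR => ?_⟩ (r⁻¹ • (x - c)) ?_
  · rw [hQ, smul_inv_smul₀ hr.ne', add_sub_cancel,
      setIntegral_ball_affine (fun y => ‖u y‖) c hr, smul_eq_mul] at h1
    exact h1
  -- Orthogonality is transported by pulling the test polynomial back along the inverse affine map,
  -- which does not raise its degree.
  · obtain ⟨R', hR'd, hR'⟩ := exists_polyVal_affine R (-(r⁻¹ • c)) r⁻¹
    have h2 : ∀ x : Rn n, (u (c + r • x) - polyVal Q x) * polyVal R x =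
        (fun y => (u y - polyVal P y) * polyVal R' y) (c + r • x) := by
      intro x
      simp only [hQ, hR', smul_add, inv_smul_smul₀ hr.ne', neg_add_cancel_left]
    simp_rw [h2]
    rw [setIntegral_ball_affine (fun y => (u y - polyVal P y) * polyVal R' y) c hr,
      hP.2 R' (hR'd.trans hR), smul_zero]
  · rw [mem_closedBall_zero_iff, norm_smul, norm_inv, Real.norm_eq_abs, abs_of_pos hr,
      inv_mul_le_iff₀ hr, mul_one]
    exact mem_closedBall_iff_norm.1 hx

/-! ### Whitney's theorem on the unit ball -/

/-- The value of a polynomial in two groups of `n` variables. -/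
def polyVal₂ {n : ℕ} (Q : MvPolynomial (Fin n ⊕ Fin n) ℂ) (x y : Rn n) : ℂ :=
  MvPolynomial.eval (Sum.elim (fun i => ((x i : ℝ) : ℂ)) fun i => ((y i : ℝ) : ℂ)) Q

theorem continuous_polyVal₂ {n : ℕ} (Q : MvPolynomial (Fin n ⊕ Fin n) ℂ) (x : Rn n) :
    Continuous (polyVal₂ Q x) := by
  have h1 : Continuous fun y : Fin n ⊕ Fin n → ℂ => MvPolynomial.eval y Q :=
    MvPolynomial.continuous_eval Q
  refine h1.comp (continuous_pi fun i => ?_)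
  rcases i with i | i
  · simp only [Sum.elim_inl]; fun_prop
  · simp only [Sum.elim_inr]; fun_prop

/-- Integrating out the second group of variables leaves a polynomial. -/
theorem exists_polyVal_eq_integral {n : ℕ} (Q : MvPolynomial (Fin n ⊕ Fin n) ℂ) {w : Rn n → ℂ}
    {r : ℝ} (hw : IntegrableOn w (Metric.closedBall 0 r)) :
    ∃ P : MvPolynomial (Fin n) ℂ, P.totalDegree ≤ Q.totalDegree ∧
      ∀ x, polyVal P x = ∫ y in Metric.closedBall 0 r, w y * polyVal₂ Q x y := by
  let mon : (Fin n ⊕ Fin n →₀ ℕ) → Rn n → ℂ := fun m y => ∏ i, ((y i : ℝ) : ℂ) ^ m (Sum.inr i)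
  have hmon : ∀ m, Continuous (mon m) := fun m => by fun_prop
  refine ⟨∑ m ∈ Q.support, MvPolynomial.C (Q.coeff m * ∫ y in Metric.closedBall 0 r, w y * mon m y)
    * ∏ i, MvPolynomial.X i ^ m (Sum.inl i), ?_, fun x => ?_⟩
  · refine MvPolynomial.totalDegree_finsetSum_le fun m hm => ?_
    refine (MvPolynomial.totalDegree_mul _ _).trans ?_
    rw [MvPolynomial.totalDegree_C, zero_add]
    refine (MvPolynomial.totalDegree_finsetProd _ _).trans ?_
    refine le_trans ?_ (MvPolynomial.le_totalDegree hm)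
    rw [Finsupp.sum_fintype _ _ (fun _ => rfl), Fintype.sum_sum_type]
    refine le_trans (Finset.sum_le_sum fun i _ => ?_) (Nat.le_add_right _ _)
    exact (MvPolynomial.totalDegree_X_pow _ _).le
  · have hval : ∀ y, w y * polyVal₂ Q x y = ∑ m ∈ Q.support,
        (Q.coeff m * ∏ i, ((x i : ℝ) : ℂ) ^ m (Sum.inl i)) * (w y * mon m y) := by
      intro y
      rw [polyVal₂, MvPolynomial.eval_eq', Finset.mul_sum]
      refine Finset.sum_congr rfl fun m _ => ?_
      rw [Fintype.prod_sum_type]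
      simp only [Sum.elim_inl, Sum.elim_inr, mon]
      ring
    simp_rw [hval]
    rw [integral_finsetSum _ fun m _ => Integrable.const_mul
      (hw.mul_continuousOn (hmon m).continuousOn (isCompact_closedBall 0 r)) _]
    simp_rw [integral_const_mul]
    simp only [polyVal, map_sum, map_mul, MvPolynomial.eval_C, map_prod, map_pow,
      MvPolynomial.eval_X]
    refine Finset.sum_congr rfl fun m _ => ?_
    ring

/-- With `exists_polyVal_eq_integral`, this shows that averaging a polynomial over the dilations `(1
- t)x + ty` yields a polynomial of no larger degree. -/
theorem exists_polyVal₂_convexComb {n : ℕ} (P : MvPolynomial (Fin n) ℂ) (s t : ℝ) :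
    ∃ Q : MvPolynomial (Fin n ⊕ Fin n) ℂ, Q.totalDegree ≤ P.totalDegree ∧
      ∀ x y, polyVal₂ Q x y = polyVal P (s • x + t • y) := by
  refine ⟨MvPolynomial.bind₁ (fun i => MvPolynomial.C (s : ℂ) * MvPolynomial.X (Sum.inl i) +
    MvPolynomial.C (t : ℂ) * MvPolynomial.X (Sum.inr i)) P, totalDegree_bind₁_le (fun i => ?_) P,
    fun x y => ?_⟩
  · refine (MvPolynomial.totalDegree_add _ _).trans (max_le ?_ ?_) <;>
    · refine (MvPolynomial.totalDegree_mul _ _).trans ?_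
      simp
  · simp only [polyVal, polyVal₂]
    rw [MvPolynomial.eval, MvPolynomial.eval₂Hom_bind₁]
    congr 2
    funext i
    simp

/-- Stone–Weierstrass for polynomials in a family of separating functions. -/
theorem exists_mvPolynomial_near {X ι : Type*} [TopologicalSpace X] [CompactSpace X]
    (co : ι → C(X, ℝ)) (hco : ∀ z w, (∀ i, co i z = co i w) → z = w) (f : C(X, ℝ))
    {ε : ℝ} (hε : 0 < ε) :
    ∃ Q : MvPolynomial ι ℝ, ∀ z, |f z - MvPolynomial.eval (fun i => co i z) Q| ≤ ε := by
  let φ : MvPolynomial ι ℝ →ₐ[ℝ] C(X, ℝ) := MvPolynomial.aeval co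
  have hsep : φ.range.SeparatesPoints := by
    intro z w hzw
    have : ∃ i, co i z ≠ co i w := by
      by_contra! hcon
      exact hzw (hco z w hcon)
    obtain ⟨i, hi⟩ := this
    exact ⟨co i, ⟨co i, ⟨MvPolynomial.X i, by simp [φ]⟩, rfl⟩, hi⟩
  obtain ⟨⟨q, Q, hQ⟩, hq⟩ :=
    ContinuousMap.exists_mem_subalgebra_near_continuousMap_of_separatesPoints φ.range hsep f ε hε
  refine ⟨Q, fun z => ?_⟩
  have h1 : ‖(q - f) z‖ ≤ ε := (ContinuousMap.norm_coe_le_norm (q - f) z).trans hq.le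
  have h3 : q z = MvPolynomial.eval (fun i => co i z) Q := by
    rw [← hQ]
    change ContinuousMap.evalAlgHom ℝ ℝ z (MvPolynomial.aeval co Q) = _
    rw [MvPolynomial.comp_aeval_apply, MvPolynomial.aeval_eq_eval]
    rfl
  rw [← h3, abs_sub_comm]
  exact h1

/-- Polynomials in `2n` variables are dense in the continuous functions on a product of balls. -/
theorem exists_polyVal₂_near {n : ℕ} {k : Rn n → Rn n → ℝ}
    (hk : Continuous fun z : Rn n × Rn n => k z.1 z.2) {ε : ℝ} (hε : 0 < ε) :
    ∃ Q : MvPolynomial (Fin n ⊕ Fin n) ℂ, ∀ x ∈ Metric.closedBall (0 : Rn n) 1,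
      ∀ y ∈ Metric.closedBall (0 : Rn n) 1, ‖(k x y : ℂ) - polyVal₂ Q x y‖ ≤ ε := by
  obtain ⟨Q, hQ⟩ := exists_mvPolynomial_near
    (X := Metric.closedBall (0 : Rn n) 1 × Metric.closedBall (0 : Rn n) 1) (ι := Fin n ⊕ Fin n)
    (Sum.elim (fun i => ⟨fun z => z.1.1 i, by fun_prop⟩) (fun i => ⟨fun z => z.2.1 i, by fun_prop⟩))
    (fun z w h => Prod.ext (Subtype.ext (by ext i; exact h (Sum.inl i)))
      (Subtype.ext (by ext i; exact h (Sum.inr i))))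
    ⟨fun z => k z.1.1 z.2.1, hk.comp (Continuous.prodMk
      (continuous_subtype_val.comp continuous_fst) (continuous_subtype_val.comp continuous_snd))⟩ hε
  refine ⟨MvPolynomial.map (algebraMap ℝ ℂ) Q, fun x hx y hy => ?_⟩
  have h2 : polyVal₂ (MvPolynomial.map (algebraMap ℝ ℂ) Q) x y =
      ((MvPolynomial.eval (Sum.elim (fun i => x i) fun i => y i) Q : ℝ) : ℂ) := by
    rw [polyVal₂, MvPolynomial.eval_map]
    change _ = algebraMap ℝ ℂ (MvPolynomial.eval _ Q)
    rw [← MvPolynomial.aeval_eq_eval, ← MvPolynomial.aeval_algebraMap_apply, MvPolynomial.aeval_def]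
    congr 1
    funext i
    rcases i with i | i <;> rfl
  rw [h2, ← Complex.ofReal_sub, Complex.norm_real, Real.norm_eq_abs]
  refine le_trans (le_of_eq ?_) (hQ (⟨x, hx⟩, ⟨y, hy⟩))
  exact congrArg (fun w => |k x y - MvPolynomial.eval w Q|)
    (funext fun i => by rcases i with i | i <;> rfl)

theorem exists_averaging_weight (n : ℕ) :
    ∃ φ : Rn n → ℝ, Continuous φ ∧ (∀ y, 0 ≤ φ y) ∧ (∀ y ∉ Metric.closedBall (0 : Rn n) 1, φ y = 0) ∧
      ∫ y in Metric.closedBall (0 : Rn n) 1, φ y = 1 := by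
  let b : ContDiffBump (0 : Rn n) := ⟨1 / 2, 1, by norm_num, by norm_num⟩
  have hsupp : ∀ y ∉ Metric.closedBall (0 : Rn n) 1, b.normed volume y = 0 := fun y hy => by
    have : y ∉ Function.support (b.normed volume) := by
      rw [b.support_normed_eq]
      exact fun h => hy (Metric.ball_subset_closedBall h)
    exact Function.notMem_support.1 this
  refine ⟨b.normed volume, b.continuous_normed, b.nonneg_normed, hsupp, ?_⟩
  rw [setIntegral_eq_integral_of_forall_compl_eq_zero hsupp, b.integral_normed]

theorem convexComb_mem_closedBall {n : ℕ} {t : ℝ} (ht0 : 0 ≤ t) (ht1 : t ≤ 1) {x y : Rn n}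
    (hx : x ∈ Metric.closedBall (0 : Rn n) 1) (hy : y ∈ Metric.closedBall (0 : Rn n) 1) :
    (1 - t) • x + t • y ∈ Metric.closedBall (0 : Rn n) 1 :=
  convex_closedBall 0 1 hx hy (by linarith) ht0 (by ring)

/-- Substituting `z = (1 - t)x + ty` moves the dependence on `x` from `u` to an explicit kernel,
which is continuous in `(x, z)` when `φ` is. Convexity and the support of `φ` keep the domain equal
to the unit ball. -/
theorem setIntegral_average_eq {n : ℕ} {φ : Rn n → ℝ}
    (hφ0 : ∀ y ∉ Metric.closedBall (0 : Rn n) 1, φ y = 0) {t : ℝ} (ht0 : 0 < t) (ht1 : t ≤ 1)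
    (u : Rn n → ℂ) {x : Rn n} (hx : x ∈ Metric.closedBall (0 : Rn n) 1) :
    ∫ y in Metric.closedBall (0 : Rn n) 1, φ y * u ((1 - t) • x + t • y) =
      ∫ z in Metric.closedBall (0 : Rn n) 1,
        (((t ^ n)⁻¹ * φ (t⁻¹ • (z - (1 - t) • x)) : ℝ) : ℂ) * u z := by
  rw [setIntegral_eq_integral_of_forall_compl_eq_zero fun y hy => by simp [hφ0 y hy],
    setIntegral_eq_integral_of_forall_compl_eq_zero fun z hz => ?_]
  · have h1 : ∀ y, (φ y : ℂ) * u ((1 - t) • x + t • y) =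
        (fun w => (φ (t⁻¹ • (((1 - t) • x + w) - (1 - t) • x)) : ℂ) * u ((1 - t) • x + w))
          (t • y) := by
      intro y
      simp only [add_sub_cancel_left, inv_smul_smul₀ ht0.ne']
    simp_rw [h1]
    rw [Measure.integral_comp_smul volume (fun w => (φ (t⁻¹ • (((1 - t) • x + w) - (1 - t) • x)) : ℂ)
      * u ((1 - t) • x + w)) t,
      integral_add_left_eq_self (fun z => (φ (t⁻¹ • (z - (1 - t) • x)) : ℂ) * u z),
      ← integral_smul]
    congr 1
    funext z
    simp only [finrank_euclideanSpace, Fintype.card_fin, Complex.real_smul, Complex.ofReal_mul,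
      abs_of_pos (inv_pos.2 (pow_pos ht0 n))]
    ring
  · have : φ (t⁻¹ • (z - (1 - t) • x)) = 0 := by
      refine hφ0 _ fun h => hz ?_
      have h2 := convexComb_mem_closedBall ht0.le ht1 hx h
      rwa [smul_inv_smul₀ ht0.ne', add_sub_cancel] at h2
    simp [this]

/-- The averages `x ↦ ∫ φ(y) g((1-t)x + ty) dy` are much closer to polynomials than `g` is. -/
theorem exists_polyVal_near_average {n : ℕ} {φ : Rn n → ℝ} (hφ : Continuous φ)
    (hφ0 : ∀ y ∉ Metric.closedBall (0 : Rn n) 1, φ y = 0) {t : ℝ} (ht0 : 0 < t) (ht1 : t ≤ 1)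
    {ε : ℝ} (hε : 0 < ε) :
    ∃ D₀ : ℕ, ∀ D ≥ D₀, ∀ (g : Rn n → ℂ) (P : MvPolynomial (Fin n) ℂ) (A : ℝ), Continuous g →
      P.totalDegree ≤ D → (∀ x ∈ Metric.closedBall (0 : Rn n) 1, ‖g x - polyVal P x‖ ≤ A) →
      ∃ Q : MvPolynomial (Fin n) ℂ, Q.totalDegree ≤ D ∧
        ∀ x ∈ Metric.closedBall (0 : Rn n) 1,
          ‖(∫ y in Metric.closedBall (0 : Rn n) 1, φ y * g ((1 - t) • x + t • y)) - polyVal Q x‖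
            ≤ ε * A := by
  set B : Set (Rn n) := Metric.closedBall 0 1 with hB
  have hBc : IsCompact B := isCompact_closedBall 0 1
  set v : ℝ := volume.real B
  have hv : 0 ≤ v := measureReal_nonneg
  obtain ⟨k, hkdef⟩ : ∃ k : Rn n → Rn n → ℝ,
      ∀ x z, k x z = (t ^ n)⁻¹ * φ (t⁻¹ • (z - (1 - t) • x)) := ⟨_, fun _ _ => rfl⟩
  have hk : Continuous fun z : Rn n × Rn n => k z.1 z.2 := by
    simp only [hkdef]
    fun_prop
  -- The kernel depends only on `φ` and `t`, so the degree of its approximant `T` serves as a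
  -- threshold valid for all `g`, `P` and `A`.
  obtain ⟨T, hT⟩ := exists_polyVal₂_near hk (ε := ε / (v + 1)) (by positivity)
  refine ⟨T.totalDegree, fun D hD g P A hg hP hA => ?_⟩
  have hA0 : 0 ≤ A := (norm_nonneg _).trans (hA 0 (by simp [B]))
  have hu : Continuous fun x => g x - polyVal P x := hg.sub (continuous_polyVal P)
  -- Write `g = P + (g - P)`. The average of `P` is exactly the polynomial `Q₂`. The average of `g -
  -- P` is approximated by `Q₃`, obtained by replacing the kernel with `T`, with error at most `ε
  -- A`.
  obtain ⟨Q₁, hQ₁d, hQ₁⟩ := exists_polyVal₂_convexComb P (1 - t) t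
  obtain ⟨Q₂, hQ₂d, hQ₂⟩ := exists_polyVal_eq_integral Q₁ (w := fun y => (φ y : ℂ)) (r := 1)
    ((Complex.continuous_ofReal.comp hφ).continuousOn.integrableOn_compact hBc)
  obtain ⟨Q₃, hQ₃d, hQ₃⟩ := exists_polyVal_eq_integral T (w := fun x => g x - polyVal P x) (r := 1)
    (hu.continuousOn.integrableOn_compact hBc)
  refine ⟨Q₂ + Q₃, totalDegree_add_le_of_le (hQ₂d.trans (hQ₁d.trans hP)) (hQ₃d.trans hD),
    fun x hx => ?_⟩
  have hsplit : (∫ y in B, φ y * g ((1 - t) • x + t • y)) =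
      polyVal Q₂ x + ∫ z in B, (k x z : ℂ) * (g z - polyVal P z) := by
    have h1 : ∫ z in B, (k x z : ℂ) * (g z - polyVal P z) =
        ∫ y in B, φ y * (g ((1 - t) • x + t • y) - polyVal P ((1 - t) • x + t • y)) := by
      rw [setIntegral_average_eq hφ0 ht0 ht1 (fun z => g z - polyVal P z) hx]
      simp only [hkdef, hB]
    have hφc : Continuous fun y => (φ y : ℂ) := Complex.continuous_ofReal.comp hφ
    have hlin : Continuous fun y : Rn n => (1 - t) • x + t • y := by fun_prop
    have hi1 : IntegrableOn (fun y => φ y * polyVal P ((1 - t) • x + t • y)) B :=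
      (hφc.mul ((continuous_polyVal P).comp hlin)).continuousOn.integrableOn_compact hBc
    have hi2 : IntegrableOn
        (fun y => φ y * (g ((1 - t) • x + t • y) - polyVal P ((1 - t) • x + t • y))) B :=
      (hφc.mul (hu.comp hlin)).continuousOn.integrableOn_compact hBc
    have h2 : polyVal Q₂ x = ∫ y in B, φ y * polyVal P ((1 - t) • x + t • y) := by
      rw [hQ₂]
      exact setIntegral_congr_fun measurableSet_closedBall fun y _ => by simp only [hQ₁]
    have h3 := integral_add hi1 hi2
    rw [h1, h2, ← h3]
    refine setIntegral_congr_fun measurableSet_closedBall fun y _ => ?_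
    rw [mul_sub, add_sub_cancel]
  have hkx : Continuous fun z => (k x z : ℂ) :=
    Complex.continuous_ofReal.comp (hk.comp (Continuous.prodMk_right x))
  have hTx : Continuous (polyVal₂ T x) := continuous_polyVal₂ T x
  have hi3 : IntegrableOn (fun z => (k x z : ℂ) * (g z - polyVal P z)) B :=
    (hkx.mul hu).continuousOn.integrableOn_compact hBc
  have hi4 : IntegrableOn (fun z => (g z - polyVal P z) * polyVal₂ T x z) B :=
    (hu.mul hTx).continuousOn.integrableOn_compact hBc
  have h4 := integral_sub hi3 hi4
  rw [hsplit, polyVal_add, add_sub_add_left_eq_sub, hQ₃, ← h4]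
  refine (norm_setIntegral_le_of_norm_le_const (C := ε / (v + 1) * A) hBc.measure_lt_top
    fun z hz => ?_).trans ?_
  · rw [mul_comm (g z - polyVal P z), ← sub_mul, norm_mul]
    exact mul_le_mul (hT x hx z hz) (hA z hz) (norm_nonneg _) (by positivity)
  · calc ε / (v + 1) * A * v = ε * A * (v / (v + 1)) := by ring
      _ ≤ ε * A * 1 := by gcongr; rw [div_le_one (by positivity)]; linarith
      _ = ε * A := mul_one _

/-! ### Differences of polynomials -/

/-- Iterated differences see only the points of an arithmetic progression, so the one-variable
theory of polynomial differences applies. -/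
theorem iterate_fwdDiff_eq_of_line {n : ℕ} {u : Rn n → ℂ} {x h : Rn n} {p : Polynomial ℂ} {m : ℕ}
    (hp : ∀ k ≤ m, u (x + k • h) = p.eval (k : ℂ)) :
    (fwdDiff h)^[m] u x = (fwdDiff 1)^[m] (fun z => p.eval z) 0 := by
  rw [fwdDiff_iter_eq_sum_shift, fwdDiff_iter_eq_sum_shift]
  refine Finset.sum_congr rfl fun k hk => ?_
  rw [hp k (by simpa [Nat.lt_succ_iff] using hk)]
  simp

theorem iterate_fwdDiff_polyVal_eq_zero {n M : ℕ} {P : MvPolynomial (Fin n) ℂ}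
    (hP : P.totalDegree < M) (h x : Rn n) : (fwdDiff h)^[M] (polyVal P) x = 0 := by
  let p : Polynomial ℂ := MvPolynomial.aeval
    (fun i => Polynomial.C (x i : ℂ) + Polynomial.C (h i : ℂ) * Polynomial.X) P
  have hdeg : p.natDegree < M := by
    have := MvPolynomial.aeval_natDegree_le P le_rfl
      (fun i => Polynomial.C (x i : ℂ) + Polynomial.C (h i : ℂ) * Polynomial.X) (n := 1)
      fun i => by compute_degree
    rw [mul_one] at this
    exact this.trans_lt hP
  rw [iterate_fwdDiff_eq_of_line (p := p) fun k _ => ?_,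
    Polynomial.fwdDiff_iter_eq_zero_of_degree_lt hdeg, Pi.zero_apply]
  change polyVal P (x + k • h) = Polynomial.evalRingHom (k : ℂ) (MvPolynomial.aeval _ P)
  rw [polyVal, MvPolynomial.aeval_def, Polynomial.algebraMap_eq, MvPolynomial.hom_eval₂]
  simp only [MvPolynomial.eval, MvPolynomial.coe_eval₂Hom]
  congr 1
  · ext; simp
  · funext i
    simp
    ring

theorem polyVal_smul_of_isHomogeneous {n j : ℕ} {P : MvPolynomial (Fin n) ℂ}
    (hP : P.IsHomogeneous j) (t : ℝ) (v : Rn n) : polyVal P (t • v) = (t : ℂ) ^ j * polyVal P v := by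
  rw [polyVal, polyVal, MvPolynomial.eval_eq', MvPolynomial.eval_eq', Finset.mul_sum]
  refine Finset.sum_congr rfl fun m hm => ?_
  have hsum : ∑ i, m i = j := by
    have := hP (MvPolynomial.mem_support_iff.1 hm)
    rwa [Finsupp.weight_apply, Finsupp.sum_fintype _ _ (by simp), Finset.sum_congr rfl
      fun i _ => by rw [Pi.one_apply, smul_eq_mul, mul_one]] at this
  simp only [PiLp.smul_apply, smul_eq_mul, Complex.ofReal_mul, mul_pow, Finset.prod_mul_distrib,
    Finset.prod_pow_eq_pow_sum, hsum]
  ring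

/-- If the `M`-th differences of a polynomial vanish near the origin, its degree is below `M`. -/
theorem totalDegree_lt_of_iterate_fwdDiff {n M : ℕ} (hM : 0 < M) {P : MvPolynomial (Fin n) ℂ}
    (hP : ∀ x ∈ Metric.closedBall (0 : Rn n) 1, ∀ y ∈ Metric.closedBall (0 : Rn n) 1,
      (fwdDiff ((M : ℝ)⁻¹ • (y - x)))^[M] (polyVal P) x = 0) : P.totalDegree < M := by
  by_contra! hd
  set d := P.totalDegree with hdef
  have hd0 : (0 : ℝ) < d := by exact_mod_cast hM.trans_le hd
  have hM' : (0 : ℝ) < M := by exact_mod_cast hM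
  -- For fixed `v`, the coefficient of `t^d` in `P(tv)` is the value at `v` of the top homogeneous
  -- part, and the `d`-th difference with unit step equals `d!` times it. That difference factors
  -- through `M`-th differences, which vanish. The radius `1/d` keeps `0, v, …, dv` in the unit
  -- ball.
  have htop : ∀ v ∈ Metric.ball (0 : Rn n) (1 / d),
      polyVal (MvPolynomial.homogeneousComponent d P) v = 0 := by
    intro v hv
    rw [mem_ball_zero_iff, lt_div_iff₀ hd0] at hv
    let p : Polynomial ℂ := ∑ j ∈ Finset.range (d + 1),
      Polynomial.C (polyVal (MvPolynomial.homogeneousComponent j P) v) * Polynomial.X ^ j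
    have hpP : ∀ t : ℝ, polyVal P (t • v) = p.eval (t : ℂ) := by
      intro t
      have h1 : polyVal P (t • v) = ∑ j ∈ Finset.range (d + 1),
          polyVal (MvPolynomial.homogeneousComponent j P) (t • v) := by
        conv_lhs => rw [← MvPolynomial.sum_homogeneousComponent P]
        simp [polyVal, hdef]
      rw [h1, Polynomial.eval_finsetSum]
      refine Finset.sum_congr rfl fun j _ => ?_
      rw [polyVal_smul_of_isHomogeneous (MvPolynomial.homogeneousComponent_isHomogeneous j P),
        Polynomial.eval_mul, Polynomial.eval_C, Polynomial.eval_pow, Polynomial.eval_X, mul_comm]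
    have hcoeff : p.coeff d = polyVal (MvPolynomial.homogeneousComponent d P) v := by
      simp [p, Polynomial.coeff_X_pow]
    have hdeg : p.natDegree ≤ d := by
      refine Polynomial.natDegree_sum_le_of_forall_le _ _ fun j hj => ?_
      refine (Polynomial.natDegree_C_mul_X_pow_le _ _).trans ?_
      simpa [Nat.lt_succ_iff] using hj
    have hzero : (fwdDiff 1)^[d] (fun z => p.eval z) 0 = 0 := by
      rw [← iterate_fwdDiff_eq_of_line (u := polyVal P) (x := 0) (h := v) fun k _ => by
        rw [zero_add, ← Nat.cast_smul_eq_nsmul ℝ, hpP]; simp]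
      obtain ⟨e, he⟩ := Nat.exists_eq_add_of_le' hd
      rw [he, Function.iterate_add_apply, fwdDiff_iter_eq_sum_shift]
      refine Finset.sum_eq_zero fun k hk => ?_
      have hke : k ≤ e := by simpa [Nat.lt_succ_iff] using hk
      have hmem : ∀ i ≤ d, (i : ℝ) • v ∈ Metric.closedBall (0 : Rn n) 1 := by
        intro i hi
        rw [mem_closedBall_zero_iff, norm_smul, Real.norm_natCast, mul_comm]
        refine le_trans ?_ hv.le
        gcongr
      have := hP _ (hmem k (by omega)) _ (hmem (k + M) (by omega))
      have hstep : (M : ℝ)⁻¹ • (((k + M : ℕ) : ℝ) • v - (k : ℝ) • v) = v := by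
        rw [← sub_smul, Nat.cast_add, add_sub_cancel_left, inv_smul_smul₀ hM'.ne']
      rw [hstep] at this
      rw [zero_add, ← Nat.cast_smul_eq_nsmul ℝ k v, this, smul_zero]
    by_contra hne
    rw [← hcoeff] at hne
    have hnd : p.natDegree = d := le_antisymm hdeg (Polynomial.le_natDegree_of_ne_zero hne)
    have h1 := congrFun p.fwdDiff_iter_degree_eq_factorial 0
    rw [hnd, hzero, Polynomial.leadingCoeff, hnd] at h1
    have h2 : p.coeff d * (d.factorial : ℂ) = 0 := by simpa using h1.symm
    exact (mul_ne_zero hne (by exact_mod_cast d.factorial_ne_zero)) h2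
  have hP0 : MvPolynomial.homogeneousComponent d P = 0 := by
    refine eq_zero_of_orthogonal (d := d) (c := (0 : Rn n)) (r := 1 / d) (by positivity)
      (MvPolynomial.homogeneousComponent_isHomogeneous d P).totalDegree_le fun R _ => ?_
    refine setIntegral_eq_zero_of_forall_eq_zero fun x hx => ?_
    rw [htop x hx, zero_mul]
  have hPne : P ≠ 0 := by
    rintro rfl
    simp [hdef] at hd0
  obtain ⟨m, hm, hmd⟩ := Finset.exists_mem_eq_sup P.support (MvPolynomial.support_nonempty.2 hPne)
    (fun m => m.sum fun _ e => e)
  have hc := MvPolynomial.coeff_homogeneousComponent d P m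
  rw [hP0, MvPolynomial.coeff_zero, if_pos] at hc
  · exact MvPolynomial.mem_support_iff.1 hm hc.symm
  · exact hmd.symm

/-! ### Whitney's theorem -/

/-- Average the `M`-th difference of `g` from `x` towards `y` over `y` with weight `φ`. The zeroth
term is `± g(x)`; each other term is a multiple of an average of `g` with parameter `k/M > 0`, which
is far closer to a polynomial than `g` is. Solving for `g(x)` halves the old error at the cost of
`η`, and the degree bound `D` is not increased, so the step can be repeated. -/
theorem exists_polyVal_improve (n : ℕ) {M : ℕ} (hM : 0 < M) :
    ∃ D : ℕ, ∀ (g : Rn n → ℂ) (η A : ℝ) (P : MvPolynomial (Fin n) ℂ), Continuous g →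
      (∀ x ∈ Metric.closedBall (0 : Rn n) 1, ∀ y ∈ Metric.closedBall (0 : Rn n) 1,
        ‖(fwdDiff ((M : ℝ)⁻¹ • (y - x)))^[M] g x‖ ≤ η) →
      P.totalDegree ≤ D → (∀ x ∈ Metric.closedBall (0 : Rn n) 1, ‖g x - polyVal P x‖ ≤ A) →
      ∃ Q : MvPolynomial (Fin n) ℂ, Q.totalDegree ≤ D ∧
        ∀ x ∈ Metric.closedBall (0 : Rn n) 1, ‖g x - polyVal Q x‖ ≤ η + A / 2 := by
  obtain ⟨φ, hφ, hφ0, hφsupp, hφint⟩ := exists_averaging_weight n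
  set B : Set (Rn n) := Metric.closedBall 0 1 with hB
  have hBc : IsCompact B := isCompact_closedBall 0 1
  have hM' : (0 : ℝ) < M := by exact_mod_cast hM
  set t : ℕ → ℝ := fun k => (k : ℝ) / M with ht
  have hD : ∀ k : ℕ, ∃ D₀ : ℕ, k < M → ∀ D ≥ D₀, ∀ (g : Rn n → ℂ) (P : MvPolynomial (Fin n) ℂ)
      (A : ℝ), Continuous g → P.totalDegree ≤ D → (∀ x ∈ B, ‖g x - polyVal P x‖ ≤ A) →
      ∃ Q : MvPolynomial (Fin n) ℂ, Q.totalDegree ≤ D ∧ ∀ x ∈ B,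
          ‖(∫ y in B, φ y * g ((1 - t (k + 1)) • x + t (k + 1) • y)) - polyVal Q x‖
            -- There are `M` such terms with binomial coefficients at most `2^M`, so this precision
            -- makes their total error `A/2`.
            ≤ 1 / (2 * M * 2 ^ M) * A := by
    intro k
    by_cases hk : k < M
    · obtain ⟨D₀, h⟩ := exists_polyVal_near_average hφ hφsupp (t := t (k + 1))
        (by simp only [ht]; positivity)
        (by simp only [ht]; rw [div_le_one hM']; exact_mod_cast hk)
        (ε := 1 / (2 * M * 2 ^ M)) (by positivity)
      exact ⟨D₀, fun _ => h⟩
    · exact ⟨0, fun h => absurd h hk⟩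
  choose D₀ hD₀ using hD
  refine ⟨(Finset.range M).sup D₀, fun g η A P hg hη hP hA => ?_⟩
  set D := (Finset.range M).sup D₀
  have hQ : ∀ k : ℕ, ∃ Q : MvPolynomial (Fin n) ℂ, Q.totalDegree ≤ D ∧ (k < M → ∀ x ∈ B,
      ‖(∫ y in B, φ y * g ((1 - t (k + 1)) • x + t (k + 1) • y)) - polyVal Q x‖
        ≤ 1 / (2 * M * 2 ^ M) * A) := by
    intro k
    by_cases hk : k < M
    · obtain ⟨Q, h1, h2⟩ := hD₀ k hk D (Finset.le_sup (Finset.mem_range.2 hk)) g P A hg hP hA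
      exact ⟨Q, h1, fun _ => h2⟩
    · exact ⟨0, by simp, fun h => absurd h hk⟩
  choose Q hQd hQ using hQ
  set w : ℕ → ℂ := fun k => (((-1) ^ (M - k) * (M.choose k : ℤ) : ℤ) : ℂ) with hw
  have hwle : ∀ k, ‖w k‖ ≤ 2 ^ M := by
    intro k
    simp only [hw]
    push_cast
    rw [norm_mul, norm_pow, norm_neg, norm_one, one_pow, one_mul, Complex.norm_natCast]
    exact_mod_cast Nat.choose_le_two_pow M k
  -- The weight `w 0` is a sign, so multiplying by it solves the averaged identity for `g x`.
  have hw0 : w 0 * w 0 = 1 := by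
    simp only [hw]
    push_cast
    rw [Nat.choose_zero_right, Nat.cast_one, mul_one, ← mul_pow]
    norm_num
  have hw0n : ‖w 0‖ = 1 := by
    have := congrArg norm hw0
    rw [norm_mul, norm_one] at this
    nlinarith [norm_nonneg (w 0)]
  refine ⟨MvPolynomial.C (-w 0) * ∑ k ∈ Finset.range M, MvPolynomial.C (w (k + 1)) * Q k,
    ?_, fun x hx => ?_⟩
  · refine (MvPolynomial.totalDegree_mul _ _).trans ?_
    rw [MvPolynomial.totalDegree_C, zero_add]
    refine MvPolynomial.totalDegree_finsetSum_le fun k _ => ?_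
    refine (MvPolynomial.totalDegree_mul _ _).trans ?_
    rw [MvPolynomial.totalDegree_C, zero_add]
    exact hQd k
  have hA0 : 0 ≤ A := (norm_nonneg _).trans (hA 0 (by simp [B]))
  have hφc : Continuous fun y => (φ y : ℂ) := Complex.continuous_ofReal.comp hφ
  have hint : ∀ s s' : ℝ, IntegrableOn (fun y => φ y * g (s • x + s' • y)) B := fun s s' =>
    (hφc.mul (hg.comp (by fun_prop))).continuousOn.integrableOn_compact hBc
  have hφint' : ∫ y in B, (φ y : ℂ) = 1 := by
    rw [integral_complex_ofReal, hφint, Complex.ofReal_one]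
  have hexp : ∀ y, (φ y : ℂ) * (fwdDiff ((M : ℝ)⁻¹ • (y - x)))^[M] g x =
      ∑ k ∈ Finset.range (M + 1), w k * (φ y * g ((1 - t k) • x + t k • y)) := by
    intro y
    rw [fwdDiff_iter_eq_sum_shift, Finset.mul_sum]
    refine Finset.sum_congr rfl fun k _ => ?_
    have harg : x + k • (M : ℝ)⁻¹ • (y - x) = (1 - t k) • x + t k • y := by
      rw [← Nat.cast_smul_eq_nsmul ℝ, smul_smul, ← div_eq_mul_inv, smul_sub, sub_smul, one_smul]
      abel
    rw [harg, zsmul_eq_mul]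
    ring
  have hmain : ∫ y in B, (φ y : ℂ) * (fwdDiff ((M : ℝ)⁻¹ • (y - x)))^[M] g x =
      (∑ k ∈ Finset.range M, w (k + 1) *
        ∫ y in B, φ y * g ((1 - t (k + 1)) • x + t (k + 1) • y)) + w 0 * g x := by
    simp_rw [hexp]
    rw [integral_finsetSum _ fun k _ => (hint _ _).const_mul _, Finset.sum_range_succ']
    simp_rw [integral_const_mul]
    congr 2
    have : ∀ y : Rn n, (φ y : ℂ) * g ((1 - t 0) • x + t 0 • y) = φ y * g x := by
      intro y
      simp [ht]
    simp_rw [this]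
    rw [integral_mul_const, hφint', one_mul]
  have hbound : ‖∫ y in B, (φ y : ℂ) * (fwdDiff ((M : ℝ)⁻¹ • (y - x)))^[M] g x‖ ≤ η := by
    calc _ ≤ ∫ y in B, φ y * η := by
          refine norm_integral_le_of_norm_le
            ((hφ.continuousOn.integrableOn_compact hBc).mul_const η) ?_
          refine (ae_restrict_iff' measurableSet_closedBall).2
            (Filter.Eventually.of_forall fun y hy => ?_)
          rw [norm_mul, Complex.norm_real, Real.norm_of_nonneg (hφ0 y)]
          exact mul_le_mul_of_nonneg_left (hη x hx y hy) (hφ0 y)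
      _ = η := by rw [integral_mul_const, hφint, one_mul]
  have hval : polyVal (MvPolynomial.C (-w 0) * ∑ k ∈ Finset.range M,
      MvPolynomial.C (w (k + 1)) * Q k) x =
      -w 0 * ∑ k ∈ Finset.range M, w (k + 1) * polyVal (Q k) x := by
    simp [polyVal]
  have hid : g x - -w 0 * ∑ k ∈ Finset.range M, w (k + 1) * polyVal (Q k) x =
      w 0 * ((∫ y in B, (φ y : ℂ) * (fwdDiff ((M : ℝ)⁻¹ • (y - x)))^[M] g x) -
        ∑ k ∈ Finset.range M, w (k + 1) *
          ((∫ y in B, φ y * g ((1 - t (k + 1)) • x + t (k + 1) • y)) - polyVal (Q k) x)) := by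
    rw [hmain]
    simp_rw [mul_sub, Finset.sum_sub_distrib]
    linear_combination (-g x) * hw0
  rw [hval, hid, norm_mul, hw0n, one_mul]
  refine (norm_sub_le _ _).trans (add_le_add hbound ?_)
  calc _ ≤ ∑ k ∈ Finset.range M, 2 ^ M * (1 / (2 * M * 2 ^ M) * A) := by
        refine norm_sum_le_of_le _ fun k hk => ?_
        rw [norm_mul]
        exact mul_le_mul (hwle _) (hQ k (Finset.mem_range.1 hk) x hx) (norm_nonneg _) (by positivity)
    _ = A / 2 := by
        rw [Finset.sum_const, Finset.card_range, nsmul_eq_mul]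
        field_simp

/-- Iterating `A ↦ η + A/2` drives the error towards `2η`. Stopping once the remaining part is at
most `η` gives `3η`. The bound `L` of `g` on the ball affects only the number of iterations. -/
theorem exists_polyVal_near_highDegree (n : ℕ) {M : ℕ} (hM : 0 < M) :
    ∃ D : ℕ, ∀ (g : Rn n → ℂ) (η : ℝ), Continuous g → 0 < η →
      (∀ x ∈ Metric.closedBall (0 : Rn n) 1, ∀ y ∈ Metric.closedBall (0 : Rn n) 1,
        ‖(fwdDiff ((M : ℝ)⁻¹ • (y - x)))^[M] g x‖ ≤ η) →
      ∃ Q : MvPolynomial (Fin n) ℂ, Q.totalDegree ≤ D ∧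
        ∀ x ∈ Metric.closedBall (0 : Rn n) 1, ‖g x - polyVal Q x‖ ≤ 3 * η := by
  obtain ⟨D, H⟩ := exists_polyVal_improve n hM
  refine ⟨D, fun g η hg hη hD => ?_⟩
  obtain ⟨L, hL⟩ := (isCompact_closedBall (0 : Rn n) 1).exists_bound_of_continuousOn hg.continuousOn
  have hiter : ∀ i : ℕ, ∃ Q : MvPolynomial (Fin n) ℂ, Q.totalDegree ≤ D ∧
      ∀ x ∈ Metric.closedBall (0 : Rn n) 1, ‖g x - polyVal Q x‖ ≤ 2 * η + L * (1 / 2) ^ i := by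
    intro i
    induction i with
    | zero =>
      refine ⟨0, by simp, fun x hx => ?_⟩
      have := hL x hx
      simp only [polyVal, map_zero, sub_zero, pow_zero, mul_one]
      linarith
    | succ i ih =>
      obtain ⟨P, hP, hPle⟩ := ih
      obtain ⟨Q, hQ, hQle⟩ := H g η _ P hg hD hP hPle
      refine ⟨Q, hQ, fun x hx => (hQle x hx).trans (le_of_eq ?_)⟩
      rw [pow_succ]
      ring
  have htend : Filter.Tendsto (fun i : ℕ => L * (1 / 2 : ℝ) ^ i) Filter.atTop (nhds (L * 0)) :=
    (tendsto_pow_atTop_nhds_zero_of_lt_one (by norm_num) (by norm_num)).const_mul L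
  rw [mul_zero] at htend
  obtain ⟨i, hi⟩ := (htend.eventually_le_const hη).exists
  obtain ⟨Q, hQ, hQle⟩ := hiter i
  exact ⟨Q, hQ, fun x hx => (hQle x hx).trans (by linarith)⟩

/-- The `M`-th differences of a polynomial of degree at most `D`, as a linear map. -/
def polyDiff (n D M : ℕ) : MvPolynomial.restrictTotalDegree (Fin n) ℂ D →ₗ[ℂ]
    C(Metric.closedBall (0 : Rn n) 1 × Metric.closedBall (0 : Rn n) 1, ℂ) where
  toFun P := ⟨fun z => (fwdDiff ((M : ℝ)⁻¹ • (z.2.1 - z.1.1)))^[M] (polyVal P.1) z.1.1, by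
    simp_rw [fwdDiff_iter_eq_sum_shift]
    have := continuous_polyVal P.1
    fun_prop⟩
  map_add' P Q := by
    ext z
    have : polyVal (P + Q).1 = polyVal P.1 + polyVal Q.1 := funext fun x => polyVal_add _ _ x
    change (fwdDiff _)^[M] (polyVal (P + Q).1) _ = _
    rw [this, fwdDiff_iter_add]
    rfl
  map_smul' w P := by
    ext z
    have : polyVal (w • P).1 = w • polyVal P.1 := funext fun x => by simp [polyVal]
    change (fwdDiff _)^[M] (polyVal (w • P).1) _ = _
    rw [this, fwdDiff_iter_const_smul]
    rfl

/-- Whitney's theorem on the unit ball. -/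
theorem whitney_unit (n : ℕ) {M : ℕ} (hM : 0 < M) :
    ∃ C : ℝ, 0 < C ∧ ∀ (g : Rn n → ℂ) (η : ℝ), Continuous g → 0 < η →
      (∀ x ∈ Metric.closedBall (0 : Rn n) 1, ∀ y ∈ Metric.closedBall (0 : Rn n) 1,
        ‖(fwdDiff ((M : ℝ)⁻¹ • (y - x)))^[M] g x‖ ≤ η) →
      ∃ Q : MvPolynomial (Fin n) ℂ, Q.totalDegree < M ∧
        ∀ x ∈ Metric.closedBall (0 : Rn n) 1, ‖g x - polyVal Q x‖ ≤ C * η := by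
  obtain ⟨D, H⟩ := exists_polyVal_near_highDegree n hM
  obtain ⟨C, hC, HC⟩ := exists_ker_near (polyRestrict n D (Metric.closedBall 0 1)) (polyDiff n D M)
  refine ⟨3 + C * (1 + 2 ^ M * 3), by positivity, fun g η hg hη hD => ?_⟩
  have hM' : (0 : ℝ) < M := by exact_mod_cast hM
  obtain ⟨P, hP, hgP⟩ := H g η hg hη hD
  have hPV : P ∈ MvPolynomial.restrictTotalDegree (Fin n) ℂ D :=
    (MvPolynomial.mem_restrictTotalDegree (Fin n) D _).2 hP
  -- The high-degree approximant `P` has `M`-th differences of size `O(η)`, so by finite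
  -- dimensionality it lies within `O(η)` of a polynomial whose `M`-th differences vanish, and such
  -- a polynomial has degree below `M`.
  obtain ⟨P₀, hP₀, hle⟩ := HC ⟨P, hPV⟩
  refine ⟨P₀.1, totalDegree_lt_of_iterate_fwdDiff hM fun x hx y hy => ?_, fun x hx => ?_⟩
  · have := congrArg (fun f => f (⟨x, hx⟩, ⟨y, hy⟩)) (LinearMap.mem_ker.1 hP₀)
    exact this
  have hT : ‖polyDiff n D M ⟨P, hPV⟩‖ ≤ (1 + 2 ^ M * 3) * η := by
    refine (ContinuousMap.norm_le _ (by positivity)).2 fun z => ?_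
    obtain ⟨⟨x, hx⟩, ⟨y, hy⟩⟩ := z
    change ‖(fwdDiff ((M : ℝ)⁻¹ • (y - x)))^[M] (polyVal P) x‖ ≤ _
    have hsplit : polyVal P = g + (-1 : ℂ) • fun z => g z - polyVal P z := by
      funext z
      simp
    have hdiff : ‖(fwdDiff ((M : ℝ)⁻¹ • (y - x)))^[M] (fun z => g z - polyVal P z) x‖ ≤
        2 ^ M * 3 * η := by
      calc _ ≤ 2 ^ M * (3 * η) := by
            refine norm_iterate_fwdDiff_le_of_line fun k hkM => hgP _ ?_
            have := convexComb_mem_closedBall (t := k / M) (by positivity)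
              (by rw [div_le_one hM']; exact_mod_cast hkM) hx hy
            convert this using 1
            rw [← Nat.cast_smul_eq_nsmul ℝ, smul_smul, ← div_eq_mul_inv, smul_sub, sub_smul,
              one_smul]
            abel
        _ = 2 ^ M * 3 * η := by ring
    rw [hsplit, fwdDiff_iter_add, fwdDiff_iter_const_smul, Pi.add_apply, Pi.smul_apply]
    refine (norm_add_le _ _).trans ?_
    rw [norm_smul, norm_neg, norm_one, one_mul, add_mul, one_mul]
    exact add_le_add (hD x hx y hy) hdiff
  have h1 := (norm_polyVal_le_polyRestrict _ hx).trans hle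
  have h2 : polyVal (⟨P, hPV⟩ - P₀ : MvPolynomial.restrictTotalDegree (Fin n) ℂ D).1 x =
      polyVal P x - polyVal P₀.1 x := polyVal_sub _ _ x
  rw [h2] at h1
  calc ‖g x - polyVal P₀.1 x‖ = ‖(g x - polyVal P x) + (polyVal P x - polyVal P₀.1 x)‖ := by
        rw [sub_add_sub_cancel]
    _ ≤ 3 * η + C * ((1 + 2 ^ M * 3) * η) :=
        (norm_add_le _ _).trans (add_le_add (hgP x hx)
          (h1.trans (mul_le_mul_of_nonneg_left hT hC.le)))
    _ = _ := by ring

/-- Whitney's theorem on balls. -/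
theorem whitney (n : ℕ) {M : ℕ} (hM : 0 < M) :
    ∃ C : ℝ, 0 < C ∧ ∀ (g : Rn n → ℂ) (c : Rn n) (r η : ℝ), Continuous g → 0 < r → 0 < η →
      (∀ h x : Rn n, ‖h‖ ≤ 2 * r → ‖(fwdDiff h)^[M] g x‖ ≤ η) →
      ∃ Q : MvPolynomial (Fin n) ℂ, Q.totalDegree < M ∧
        ∀ x ∈ Metric.closedBall c r, ‖g x - polyVal Q x‖ ≤ C * η := by
  obtain ⟨C, hC, H⟩ := whitney_unit n hM
  refine ⟨C, hC, fun g c r η hg hr hη hD => ?_⟩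
  have hM' : (1 : ℝ) ≤ M := by exact_mod_cast hM
  obtain ⟨Q, hQ, hgQ⟩ := H (fun x => g (c + r • x)) η (hg.comp (by fun_prop)) hη
    fun x hx y hy => by
      have h1 : ∀ h : Rn n, (fwdDiff h)^[M] (fun x => g (c + r • x)) x =
          (fwdDiff (r • h))^[M] g (c + r • x) := by
        intro h
        rw [fwdDiff_iter_eq_sum_shift, fwdDiff_iter_eq_sum_shift]
        refine Finset.sum_congr rfl fun k _ => ?_
        rw [smul_add, smul_comm r k h, add_assoc]
      rw [h1]
      refine hD _ _ ?_
      rw [mem_closedBall_zero_iff] at hx hy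
      rw [norm_smul, norm_smul, norm_inv, Real.norm_natCast, Real.norm_of_nonneg hr.le, mul_comm 2]
      refine mul_le_mul_of_nonneg_left ?_ hr.le
      calc (M : ℝ)⁻¹ * ‖y - x‖ ≤ 1 * ‖y - x‖ := by
            gcongr
            exact inv_le_one_of_one_le₀ hM'
        _ ≤ 2 := by linarith [norm_sub_le y x]
  obtain ⟨Q', hQ'd, hQ'⟩ := exists_polyVal_affine Q (-(r⁻¹ • c)) r⁻¹
  refine ⟨Q', hQ'd.trans_lt hQ, fun x hx => ?_⟩
  have h2 := hgQ (r⁻¹ • (x - c)) (by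
    rw [mem_closedBall_zero_iff, norm_smul, norm_inv, Real.norm_of_nonneg hr.le,
      inv_mul_le_iff₀ hr, mul_one]
    exact mem_closedBall_iff_norm.1 hx)
  rw [smul_inv_smul₀ hr.ne', add_sub_cancel] at h2
  rwa [hQ', neg_add_eq_sub, ← smul_sub]

/-! ### Oscillation of Lipschitz functions -/

theorem volume_real_ball {n : ℕ} (c : Rn n) {r : ℝ} (hr : 0 < r) :
    volume.real (Metric.ball c r) = r ^ n * volume.real (Metric.ball (0 : Rn n) 1) := by
  rw [Measure.real, Measure.addHaar_ball_of_pos volume c hr, ENNReal.toReal_mul,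
    ENNReal.toReal_ofReal (by positivity), finrank_euclideanSpace, Fintype.card_fin, Measure.real]

/-- Subtracting a polynomial lets the `L¹` bound for minimizing polynomials control how far they are
from any other polynomial of degree at most `d`. -/
theorem IsMinimizingPoly.sub_polyVal {n d : ℕ} {B : Set (Rn n)} {u : Rn n → ℂ}
    {P Q : MvPolynomial (Fin n) ℂ} (hP : IsMinimizingPoly d B u P) (hQ : Q.totalDegree ≤ d) :
    IsMinimizingPoly d B (fun x => u x - polyVal Q x) (P - Q) := by
  refine ⟨totalDegree_sub_le_of_le hP.1 hQ, fun R hR => ?_⟩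
  simpa only [polyVal_sub, sub_sub_sub_cancel_right] using hP.2 R hR

/-- Whitney's theorem supplies some `Q` of degree at most `M - 1` with `u - Q = O(r^a)` on the ball.
The minimizing polynomial does as well up to a constant, because `P - Q` is the minimizing
polynomial of `u - Q` and is bounded by the mean of `|u - Q|`. -/
theorem integral_norm_sub_minimizingPoly_le (n : ℕ) {M : ℕ} (hM : 0 < M) {a : ℝ} (ha : 0 < a) :
    ∃ C : ℝ, 0 < C ∧ ∀ (u : Rn n → ℂ) (A : ℝ), Continuous u → 0 < A →
      (∀ h x, ‖(fwdDiff h)^[M] u x‖ ≤ A * ‖h‖ ^ a) →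
      ∀ (c : Rn n) (r : ℝ) (P : MvPolynomial (Fin n) ℂ), 0 < r →
        IsMinimizingPoly (M - 1) (Metric.ball c r) u P →
        ∫ x in Metric.ball c r, ‖u x - polyVal P x‖ ≤
          C * A * r ^ a * volume.real (Metric.ball c r) := by
  obtain ⟨C, hC, H⟩ := whitney n hM
  obtain ⟨C', hC', H'⟩ := norm_polyVal_le_of_isMinimizingPoly n (M - 1)
  set v : ℝ := volume.real (Metric.ball (0 : Rn n) 1) with hv
  have hv0 : 0 ≤ v := measureReal_nonneg
  refine ⟨(1 + C' * v) * (C * 2 ^ a), by positivity, fun u A hu hA hD c r P hr hP => ?_⟩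
  have h2r : 0 < 2 * r := by positivity
  obtain ⟨Q, hQ, huQ⟩ := H u c r (A * (2 * r) ^ a) hu hr (by positivity) fun h x hh =>
    (hD h x).trans (by gcongr)
  have hfin : volume (Metric.ball c r) < ∞ := measure_ball_lt_top
  have hcint : ∀ w : Rn n → ℂ, Continuous w → IntegrableOn w (Metric.ball c r) := fun w hw =>
    (hw.continuousOn.integrableOn_compact (isCompact_closedBall c r)).mono_set
      Metric.ball_subset_closedBall
  have hw : Continuous fun x => u x - polyVal Q x := hu.sub (continuous_polyVal Q)
  set η := C * (A * (2 * r) ^ a) with hη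
  have hη0 : 0 ≤ η := by positivity
  set V := volume.real (Metric.ball c r) with hV
  have hVv : V = r ^ n * v := volume_real_ball c hr
  have hI : ∫ x in Metric.ball c r, ‖u x - polyVal Q x‖ ≤ η * V := by
    have h0 := norm_setIntegral_le_of_norm_le_const (f := fun x => ‖u x - polyVal Q x‖) (C := η) hfin
      fun x hx => by
        rw [norm_norm]
        exact huQ x (Metric.ball_subset_closedBall hx)
    exact (Real.le_norm_self _).trans h0
  have hsup : ∀ x ∈ Metric.ball c r, ‖polyVal (P - Q) x‖ ≤ C' * v * η := by
    intro x hx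
    refine (H' _ _ c r hr (hcint _ hw) (hP.sub_polyVal (by omega)) x
      (Metric.ball_subset_closedBall hx)).trans ?_
    rw [mul_assoc]
    refine mul_le_mul_of_nonneg_left ?_ hC'.le
    rw [inv_mul_le_iff₀ (by positivity)]
    refine hI.trans (le_of_eq ?_)
    rw [hVv]
    ring
  calc ∫ x in Metric.ball c r, ‖u x - polyVal P x‖
      ≤ ∫ _x in Metric.ball c r, (η + C' * v * η) := by
        refine setIntegral_mono_on (hcint _ (hu.sub (continuous_polyVal P))).norm
          (integrableOn_const hfin.ne) measurableSet_ball fun x hx => ?_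
        calc ‖u x - polyVal P x‖ = ‖(u x - polyVal Q x) - polyVal (P - Q) x‖ := by
              rw [polyVal_sub]; congr 1; ring
          _ ≤ _ := (norm_sub_le _ _).trans
              (add_le_add (huQ x (Metric.ball_subset_closedBall hx)) (hsup x hx))
    _ = _ := by
        rw [setIntegral_const, smul_eq_mul, hη, Real.mul_rpow (by norm_num) hr.le]
        ring

/-! ### From Campanato bounds to Lipschitz bounds -/

/-- The small ball lies in the double ball, and the difference of the two polynomials is the
minimizing polynomial on the small ball of `u` minus the larger ball's polynomial. Its size is thus
controlled by the oscillation on the larger ball, the volume ratio costing `2^n`. -/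
theorem norm_minimizingPoly_sub_le (n d : ℕ) {a : ℝ} :
    ∃ C : ℝ, 0 < C ∧ ∀ (u : Rn n → ℂ) (N r₀ : ℝ), LocallyIntegrable u volume → 0 ≤ N →
      (∀ (c : Rn n) (r : ℝ), 0 < r → r < r₀ →
        ∫ x in Metric.ball c r, ‖u x - polyVal (minimizingPoly d (Metric.ball c r) u) x‖ ≤
          N * r ^ a * volume.real (Metric.ball c r)) →
      ∀ (c y : Rn n) (s : ℝ), 0 < s → 2 * s < r₀ → dist y c ≤ s → ∀ z ∈ Metric.closedBall y s,
        ‖polyVal (minimizingPoly d (Metric.ball y s) u) z -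
          polyVal (minimizingPoly d (Metric.ball c (2 * s)) u) z‖ ≤ C * N * s ^ a := by
  obtain ⟨C', hC', H'⟩ := norm_polyVal_le_of_isMinimizingPoly n d
  set v : ℝ := volume.real (Metric.ball (0 : Rn n) 1) with hv
  have hv0 : 0 ≤ v := measureReal_nonneg
  refine ⟨C' * 2 ^ a * 2 ^ n * (v + 1), by positivity, fun u N r₀ hu hN hosc c y s hs hs₀ hyc z hz => ?_⟩
  have h2s : 0 < 2 * s := by positivity
  set P := minimizingPoly d (Metric.ball c (2 * s)) u with hPdef
  have hP := isMinimizingPoly_minimizingPoly d hu c h2s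
  have hQ := isMinimizingPoly_minimizingPoly d hu y hs
  have hsub : Metric.ball y s ⊆ Metric.ball c (2 * s) :=
    Metric.ball_subset_ball' (by linarith)
  have hw : LocallyIntegrable (fun x => u x - polyVal P x) volume :=
    hu.sub (continuous_polyVal P).locallyIntegrable
  have hwint : ∀ (e : Rn n) (ρ : ℝ), IntegrableOn (fun x => u x - polyVal P x) (Metric.ball e ρ) :=
    fun e ρ => (hw.integrableOn_isCompact (isCompact_closedBall e ρ)).mono_set
      Metric.ball_subset_closedBall
  have h1 := H' _ _ y s hs (hwint y s) (hQ.sub_polyVal hP.1) z hz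
  rw [polyVal_sub] at h1
  refine h1.trans ?_
  have h2 : ∫ x in Metric.ball y s, ‖u x - polyVal P x‖ ≤
      ∫ x in Metric.ball c (2 * s), ‖u x - polyVal P x‖ :=
    setIntegral_mono_set (hwint c (2 * s)).norm
      (Filter.Eventually.of_forall fun x => norm_nonneg _) hsub.eventuallyLE
  have h3 := h2.trans (hosc c (2 * s) h2s hs₀)
  rw [volume_real_ball c h2s, ← hv, mul_pow, Real.mul_rpow (by norm_num) hs.le] at h3
  calc C' * ((s ^ n)⁻¹ * ∫ x in Metric.ball y s, ‖u x - polyVal P x‖)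
      ≤ C' * ((s ^ n)⁻¹ * (N * (2 ^ a * s ^ a) * (2 ^ n * s ^ n * v))) := by gcongr
    _ = C' * 2 ^ a * 2 ^ n * v * (N * s ^ a) := by field_simp
    _ ≤ C' * 2 ^ a * 2 ^ n * (v + 1) * (N * s ^ a) := by
        have : 0 ≤ N * s ^ a := by positivity
        gcongr
        linarith
    _ = _ := by ring

/-- At almost every point, the minimizing polynomials of small balls recover the function. -/
theorem ae_tendsto_minimizingPoly {n d : ℕ} {u : Rn n → ℂ} (hu : LocallyIntegrable u volume) :
    ∀ᵐ y, ∀ δ : ℕ → ℝ, (∀ m, 0 < δ m) → Filter.Tendsto δ Filter.atTop (nhds 0) →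
      Filter.Tendsto (fun m => polyVal (minimizingPoly d (Metric.ball y (δ m)) u) y)
        Filter.atTop (nhds (u y)) := by
  obtain ⟨C', hC', H'⟩ := norm_polyVal_le_of_isMinimizingPoly n d
  set v : ℝ := volume.real (Metric.ball (0 : Rn n) 1) with hv
  have hv0 : 0 < v := by
    rw [hv, measureReal_def]
    exact ENNReal.toReal_pos (Metric.measure_ball_pos volume 0 one_pos).ne' measure_ball_lt_top.ne
  filter_upwards [IsUnifLocDoublingMeasure.ae_tendsto_average_norm_sub volume hu 1] with y hy δ hδ hδ0
  have h1 := hy (l := Filter.atTop) (fun _ : ℕ => y) δ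
    (tendsto_nhdsWithin_iff.2 ⟨hδ0, Filter.Eventually.of_forall hδ⟩)
    (Filter.Eventually.of_forall fun m => Metric.mem_closedBall_self (by linarith [hδ m]))
  rw [tendsto_iff_norm_sub_tendsto_zero]
  have h2 := h1.const_mul (C' * v)
  rw [mul_zero] at h2
  refine squeeze_zero (fun m => norm_nonneg _) (fun m => ?_) h2
  have hw : LocallyIntegrable (fun x => u x - u y) volume := hu.sub (locallyIntegrable_const _)
  have hwc : IntegrableOn (fun x => u x - u y) (Metric.closedBall y (δ m)) :=
    hw.integrableOn_isCompact (isCompact_closedBall _ _)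
  have hmin := (isMinimizingPoly_minimizingPoly d hu y (hδ m)).sub_polyVal
    (Q := MvPolynomial.C (u y)) (by simp)
  simp only [polyVal_C] at hmin
  have h3 := H' _ _ y (δ m) (hδ m) (hwc.mono_set Metric.ball_subset_closedBall) hmin y
    (Metric.mem_closedBall_self (hδ m).le)
  rw [polyVal_sub, polyVal_C] at h3
  refine h3.trans ?_
  have hvol : volume.real (Metric.closedBall y (δ m)) = δ m ^ n * v := by
    rw [measureReal_def, Measure.addHaar_closedBall volume y (hδ m).le, ENNReal.toReal_mul,
      ENNReal.toReal_ofReal (pow_pos (hδ m) _).le, finrank_euclideanSpace, Fintype.card_fin, hv,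
      measureReal_def]
  rw [setAverage_eq, hvol, smul_eq_mul, mul_inv]
  have h4 : ∫ x in Metric.ball y (δ m), ‖u x - u y‖ ≤
      ∫ x in Metric.closedBall y (δ m), ‖u x - u y‖ :=
    setIntegral_mono_set hwc.norm (Filter.Eventually.of_forall fun x => norm_nonneg _)
      Metric.ball_subset_closedBall.eventuallyLE
  have hδn : 0 < δ m ^ n := pow_pos (hδ m) n
  calc C' * ((δ m ^ n)⁻¹ * ∫ x in Metric.ball y (δ m), ‖u x - u y‖)
      ≤ C' * ((δ m ^ n)⁻¹ * ∫ x in Metric.closedBall y (δ m), ‖u x - u y‖) := by gcongr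
    _ = _ := by field_simp

/-- Pass from the ball about `c` to balls about `y` of radius `r/2, r/4, …`. Consecutive polynomials
differ at `y` by a geometric sequence of ratio `2^(-a)`, and they converge to `u y` at almost every
`y`. The exceptional null set depends on neither `c` nor `r`. -/
theorem ae_norm_sub_minimizingPoly_le (n d : ℕ) {a : ℝ} (ha : 0 < a) :
    ∃ C : ℝ, 0 < C ∧ ∀ (u : Rn n → ℂ) (N r₀ : ℝ), LocallyIntegrable u volume → 0 ≤ N →
      (∀ (c : Rn n) (r : ℝ), 0 < r → r < r₀ →
        ∫ x in Metric.ball c r, ‖u x - polyVal (minimizingPoly d (Metric.ball c r) u) x‖ ≤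
          N * r ^ a * volume.real (Metric.ball c r)) →
      ∀ᵐ y, ∀ (c : Rn n) (r : ℝ), 0 < r → r < r₀ → dist y c ≤ r / 2 →
        ‖u y - polyVal (minimizingPoly d (Metric.ball c r) u) y‖ ≤ C * N * r ^ a := by
  obtain ⟨C, hC, H⟩ := norm_minimizingPoly_sub_le n d (a := a)
  have hθ0 : (0 : ℝ) < (1 / 2) ^ a := by positivity
  have hθ1 : (1 / 2 : ℝ) ^ a < 1 := Real.rpow_lt_one (by norm_num) (by norm_num) ha
  set θ : ℝ := (1 / 2) ^ a with hθ
  have hgeom : ∀ i : ℕ, ∑ j ∈ Finset.range i, θ ^ j ≤ (1 - θ)⁻¹ := fun i =>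
    (summable_geometric_of_lt_one hθ0.le hθ1).sum_le_tsum _ (fun j _ => by positivity)
      |>.trans_eq (tsum_geometric_of_lt_one hθ0.le hθ1)
  have hpos := inv_pos.2 (sub_pos.2 hθ1)
  refine ⟨C * (1 - θ)⁻¹, by positivity, fun u N r₀ hu hN hosc => ?_⟩
  have H1 := H u N r₀ hu hN hosc
  filter_upwards [ae_tendsto_minimizingPoly (d := d) hu] with y hy c r hr hr₀ hyc
  set δ : ℕ → ℝ := fun m => r / 2 * (1 / 2) ^ m with hδ
  have hδpos : ∀ m, 0 < δ m := fun m => by positivity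
  have hδ0 : Filter.Tendsto δ Filter.atTop (nhds 0) := by
    have := (tendsto_pow_atTop_nhds_zero_of_lt_one (r := (1 / 2 : ℝ)) (by norm_num)
      (by norm_num)).const_mul (r / 2)
    rwa [mul_zero] at this
  have hδle : ∀ m, δ m ≤ r / 2 := fun m =>
    mul_le_of_le_one_right (by positivity) (pow_le_one₀ (by norm_num) (by norm_num))
  have hδa : ∀ m, δ m ^ a = (r / 2) ^ a * θ ^ m := fun m => by
    simp only [hδ, hθ]
    rw [Real.mul_rpow (by positivity) (by positivity), ← Real.rpow_natCast, ← Real.rpow_natCast,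
      ← Real.rpow_mul (by norm_num), ← Real.rpow_mul (by norm_num), mul_comm (m : ℝ)]
  have hchain : ∀ m, ‖polyVal (minimizingPoly d (Metric.ball y (δ m)) u) y -
      polyVal (minimizingPoly d (Metric.ball c r) u) y‖ ≤
        C * N * (r / 2) ^ a * ∑ j ∈ Finset.range (m + 1), θ ^ j := by
    intro m
    induction m with
    | zero =>
      have h := H1 c y (r / 2) (by positivity) (by linarith) hyc y
        (Metric.mem_closedBall_self (by positivity))
      rw [mul_div_cancel₀ r two_ne_zero] at h
      simpa [hδ] using h
    | succ m ih =>
      have h2 : 2 * δ (m + 1) = δ m := by simp only [hδ, pow_succ]; ring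
      have h := H1 y y (δ (m + 1)) (hδpos _) (by rw [h2]; linarith [hδle m])
        (by rw [dist_self]; exact (hδpos _).le) y (Metric.mem_closedBall_self (hδpos _).le)
      rw [h2, hδa, ← mul_assoc] at h
      rw [Finset.sum_range_succ, mul_add]
      linarith [norm_sub_le_norm_sub_add_norm_sub
        (polyVal (minimizingPoly d (Metric.ball y (δ (m + 1))) u) y)
        (polyVal (minimizingPoly d (Metric.ball y (δ m)) u) y)
        (polyVal (minimizingPoly d (Metric.ball c r) u) y)]
  have hlim := ((hy δ hδpos hδ0).sub_const
    (polyVal (minimizingPoly d (Metric.ball c r) u) y)).norm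
  refine le_of_tendsto' hlim fun m => (hchain m).trans ?_
  have hra : (r / 2) ^ a ≤ r ^ a := Real.rpow_le_rpow (by positivity) (by linarith) ha.le
  calc _ ≤ C * N * r ^ a * (1 - θ)⁻¹ := by
        gcongr
        exact hgeom _
    _ = _ := by ring

/-- On a dense set of full measure, `u` is within `O(r^a)` of a single polynomial near each centre,
so it extends continuously. An `M`-th difference kills that polynomial and leaves only the error;
for steps that are not small, boundedness suffices. -/
theorem exists_lipschitz_of_campanato (n : ℕ) {M : ℕ} (hM : 0 < M) {a r₀ : ℝ} (ha : 0 < a)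
    (hr₀ : 0 < r₀) :
    ∃ C : ℝ, 0 < C ∧ ∀ (u : Rn n → ℂ) (L N : ℝ), LocallyIntegrable u volume → 0 ≤ N → 0 ≤ L →
      (∀ᵐ x, ‖u x‖ ≤ L) →
      (∀ (c : Rn n) (r : ℝ), 0 < r → r < r₀ →
        ∫ x in Metric.ball c r, ‖u x - polyVal (minimizingPoly (M - 1) (Metric.ball c r) u) x‖ ≤
          N * r ^ a * volume.real (Metric.ball c r)) →
      ∃ w : Rn n → ℂ, Continuous w ∧ u =ᵐ[volume] w ∧
        ∀ h x, ‖(fwdDiff h)^[M] w x‖ ≤ C * (L + N) * ‖h‖ ^ a := by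
  obtain ⟨C, hC, H⟩ := ae_norm_sub_minimizingPoly_le n (M - 1) ha
  -- With radius `ρ‖h‖`, all points `x + ih`, `i ≤ M`, lie strictly within half the radius of `x`,
  -- where the pointwise bound passes to the continuous extension.
  set ρ : ℝ := 2 * (M + 1) with hρ
  have hρ0 : 0 < ρ := by positivity
  refine ⟨2 ^ M * (C * ρ ^ a) + 2 ^ M * (ρ / r₀) ^ a, by positivity,
    fun u L N hu hN hL huL hosc => ?_⟩
  have hG := H u N r₀ hu hN hosc
  set G : Set (Rn n) := {y | ∀ (c : Rn n) (r : ℝ), 0 < r → r < r₀ → dist y c ≤ r / 2 →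
        ‖u y - polyVal (minimizingPoly (M - 1) (Metric.ball c r) u) y‖ ≤ C * N * r ^ a} with hGdef
  have hGd : Dense G := Measure.dense_of_ae hG
  have hsmall : ∀ ε > 0, ∃ r, 0 < r ∧ r < r₀ ∧ C * N * r ^ a < ε := by
    intro ε hε
    have h1 : Filter.Tendsto (fun r : ℝ => C * N * r ^ a) (nhdsWithin 0 (Set.Ioi 0))
        (nhds (C * N * 0 ^ a)) :=
      ((Real.continuousAt_rpow_const 0 a (Or.inr ha.le)).tendsto.const_mul _).mono_left
        nhdsWithin_le_nhds
    rw [Real.zero_rpow ha.ne', mul_zero] at h1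
    obtain ⟨r, hr1, hr2⟩ := ((h1.eventually_lt_const hε).and
      (Ioo_mem_nhdsGT hr₀)).exists
    exact ⟨r, hr2.1, hr2.2, hr1⟩
  have hlim : ∀ z, ∃ w, Filter.Tendsto u (nhdsWithin z G) (nhds w) := by
    intro z
    have : (nhdsWithin z G).NeBot := mem_closure_iff_nhdsWithin_neBot.1 (hGd z)
    -- Near `z`, the values of `u` on `G` stay within `ε/2` of the fixed number `P(z)`: half of this
    -- is the error `C N r^a`, half is the continuity of `P`.
    refine cauchy_map_iff_exists_tendsto.1 (Metric.cauchy_iff.2 ⟨inferInstance, fun ε hε => ?_⟩)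
    obtain ⟨r, hr, hrr₀, hrε⟩ := hsmall (ε / 4) (by positivity)
    set P := minimizingPoly (M - 1) (Metric.ball z r) u
    have hPc : ∀ᶠ y in nhds z, dist (polyVal P y) (polyVal P z) < ε / 4 :=
      Metric.tendsto_nhds.1 (continuous_polyVal P).continuousAt _ (by positivity)
    have hev : ∀ᶠ y in nhdsWithin z G, dist (u y) (polyVal P z) < ε / 2 := by
      filter_upwards [nhdsWithin_le_nhds hPc, self_mem_nhdsWithin,
        nhdsWithin_le_nhds (Metric.closedBall_mem_nhds z (by positivity : 0 < r / 2))]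
        with y h1 h2 h3
      have h4 := h2 z r hr hrr₀ h3
      rw [← dist_eq_norm] at h4
      linarith [dist_triangle (u y) (polyVal P y) (polyVal P z)]
    refine ⟨{t | dist t (polyVal P z) < ε / 2}, Filter.mem_map.2 hev, fun x hx y hy => ?_⟩
    have hx' : dist x (polyVal P z) < ε / 2 := hx
    have hy' : dist y (polyVal P z) < ε / 2 := hy
    linarith [dist_triangle_right x y (polyVal P z)]
  set w := extendFrom G u with hwdef
  have hwt : ∀ z, Filter.Tendsto u (nhdsWithin z G) (nhds (w z)) := fun z =>
    tendsto_extendFrom (hlim z)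
  have hwc : Continuous w := continuous_extendFrom hGd hlim
  have hwG : ∀ z ∈ G, u z = w z := by
    intro z hz
    have h1 : Filter.Tendsto u (pure z) (nhds (w z)) := (hwt z).mono_left (pure_le_nhdsWithin hz)
    exact tendsto_nhds_unique (tendsto_pure_nhds u z) h1
  have huw : u =ᵐ[volume] w := by
    filter_upwards [hG] with z hz using hwG z hz
  have hwL : ∀ x, ‖w x‖ ≤ L := norm_le_of_ae_norm_le hwc (by
    filter_upwards [huL, huw] with x h1 h2
    rwa [← h2])
  have hwP : ∀ (c : Rn n) (r : ℝ), 0 < r → r < r₀ → ∀ y, dist y c < r / 2 →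
      ‖w y - polyVal (minimizingPoly (M - 1) (Metric.ball c r) u) y‖ ≤ C * N * r ^ a := by
    intro c r hr hrr₀ y hy
    have : (nhdsWithin y G).NeBot := mem_closure_iff_nhdsWithin_neBot.1 (hGd y)
    refine le_of_tendsto ((hwt y).sub ((continuous_polyVal
      (minimizingPoly (M - 1) (Metric.ball c r) u)).tendsto y |>.mono_left nhdsWithin_le_nhds)).norm ?_
    filter_upwards [self_mem_nhdsWithin,
      nhdsWithin_le_nhds (Metric.isOpen_ball.mem_nhds (Metric.mem_ball.2 hy))] with z hz hzc
    exact hz c r hr hrr₀ (Metric.mem_ball.1 hzc).le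
  refine ⟨w, hwc, huw, fun h x => ?_⟩
  by_cases hh : h = 0
  · subst hh
    rw [iterate_fwdDiff_zero_step hM, norm_zero]
    positivity
  have hh0 : 0 < ‖h‖ := norm_pos_iff.2 hh
  have hha : 0 < ‖h‖ ^ a := by positivity
  by_cases hsm : ρ * ‖h‖ < r₀
  · set P := minimizingPoly (M - 1) (Metric.ball x (ρ * ‖h‖)) u with hPdef
    have hPdeg : P.totalDegree < M := by
      have : P.totalDegree ≤ M - 1 :=
        (isMinimizingPoly_minimizingPoly (M - 1) hu x (mul_pos hρ0 hh0)).1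
      omega
    have hsplit : w = (fun y => w y - polyVal P y) + polyVal P := by
      funext y
      simp
    rw [hsplit, fwdDiff_iter_add, Pi.add_apply, iterate_fwdDiff_polyVal_eq_zero hPdeg, add_zero]
    refine (norm_iterate_fwdDiff_le_of_line (K := C * N * (ρ * ‖h‖) ^ a) fun i hi =>
      hwP x _ (mul_pos hρ0 hh0) hsm _ ?_).trans ?_
    · rw [dist_self_add_left, ← Nat.cast_smul_eq_nsmul ℝ, norm_smul, Real.norm_natCast, hρ]
      have : (i : ℝ) < M + 1 := by exact_mod_cast Nat.lt_succ_of_le hi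
      nlinarith
    · rw [Real.mul_rpow hρ0.le hh0.le]
      calc 2 ^ M * (C * N * (ρ ^ a * ‖h‖ ^ a)) = 2 ^ M * (C * ρ ^ a) * N * ‖h‖ ^ a := by ring
        _ ≤ _ := by
          gcongr
          · exact le_add_of_nonneg_right (by positivity)
          · linarith
  · refine (norm_iterate_fwdDiff_le hwL h x).trans ?_
    have h1 : 1 ≤ (ρ / r₀) ^ a * ‖h‖ ^ a := by
      rw [← Real.mul_rpow (by positivity) hh0.le]
      refine Real.one_le_rpow ?_ ha.le
      rw [div_mul_eq_mul_div, le_div_iff₀ hr₀, one_mul]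
      exact not_lt.1 hsm
    calc 2 ^ M * L ≤ 2 ^ M * L * ((ρ / r₀) ^ a * ‖h‖ ^ a) :=
          le_mul_of_one_le_right (by positivity) h1
      _ = 2 ^ M * (ρ / r₀) ^ a * L * ‖h‖ ^ a := by ring
      _ ≤ _ := by
          gcongr
          · exact le_add_of_nonneg_left (by positivity)
          · linarith

/-! ### Local Campanato norms and Lipschitz norms -/

theorem volume_ball_eq_ofReal {n : ℕ} (c : Rn n) (r : ℝ) :
    volume (Metric.ball c r) = ENNReal.ofReal (volume.real (Metric.ball c r)) :=
  (ofReal_measureReal measure_ball_lt_top.ne).symm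

theorem volume_real_ball_pos {n : ℕ} (c : Rn n) {r : ℝ} (hr : 0 < r) :
    0 < volume.real (Metric.ball c r) := by
  rw [measureReal_def]
  exact ENNReal.toReal_pos (Metric.measure_ball_pos volume c hr).ne' measure_ball_lt_top.ne

/-- This identity turns the Orlicz normalization `|B|^(1/p)` into the Campanato normalization `r^a
|B|` with `a = n(1/p - 1)`. -/
theorem rpow_volume_real_ball {n : ℕ} (c : Rn n) {r : ℝ} (hr : 0 < r) (p : ℝ) :
    volume.real (Metric.ball c r) ^ (1 / p) =
      volume.real (Metric.ball (0 : Rn n) 1) ^ (1 / p - 1) * r ^ ((n : ℝ) * (1 / p - 1)) *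
        volume.real (Metric.ball c r) := by
  have hV := volume_real_ball_pos c hr
  have h1 : volume.real (Metric.ball c r) ^ (1 / p) =
      volume.real (Metric.ball c r) ^ (1 / p - 1) * volume.real (Metric.ball c r) := by
    rw [← Real.rpow_add_one hV.ne']
    congr 1
    ring
  rw [h1]
  congr 1
  rw [volume_real_ball c hr, Real.mul_rpow (by positivity) measureReal_nonneg, mul_comm,
    Real.rpow_mul hr.le, Real.rpow_natCast]

theorem integral_norm_le_of_campanato {n : ℕ} {p : ℝ} (hp0 : 0 < p) (hp1 : p < 1) {g : Rn n → ℂ}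
    (hg : g ∈ campanatoPhiPSpace n p) (c : Rn n) {r : ℝ} (hr : 0 < r)
    (hB : volume (Metric.ball c r) < 1) :
    ∫ x in Metric.ball c r,
        ‖g x - polyVal (minimizingPoly ⌊(n : ℝ) * (1 / p - 1)⌋₊ (Metric.ball c r) g) x‖ ≤
      volume.real (Metric.ball (0 : Rn n) 1) ^ (1 / p - 1) * (campanatoPhiPENorm p g).toReal *
        r ^ ((n : ℝ) * (1 / p - 1)) * volume.real (Metric.ball c r) := by
  obtain ⟨hgl, hgN⟩ := hg
  set P := minimizingPoly ⌊(n : ℝ) * (1 / p - 1)⌋₊ (Metric.ball c r) g with hP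
  set V := volume.real (Metric.ball c r) with hV
  have hV0 : 0 < V := volume_real_ball_pos c hr
  have hlux := luxemburgENorm_indicator_le hp0 hp1 (measurableSet_ball (x := c) (ε := r)) hV0
    (volume_ball_eq_ofReal c r)
  have h1 : (∫⁻ x in Metric.ball c r, ‖g x - polyVal P x‖ₑ) /
      luxemburgENorm (PhiP p) ((Metric.ball c r).indicator fun _ => 1) ≤
        campanatoPhiPENorm p g := by
    unfold campanatoPhiPENorm campanatoENorm
    refine le_trans ?_ le_self_add
    exact le_iSup_of_le c (le_iSup_of_le r (le_iSup_of_le hr (le_iSup_of_le hB le_rfl)))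
  rw [ENNReal.div_le_iff_le_mul (Or.inr hgN.ne)
    (Or.inl (hlux.trans_lt ENNReal.ofReal_lt_top).ne)] at h1
  have h2 := ENNReal.toReal_mono (ENNReal.mul_ne_top hgN.ne ENNReal.ofReal_ne_top)
    (h1.trans (mul_le_mul_right hlux _))
  have hm : AEStronglyMeasurable (fun x => g x - polyVal P x)
      (volume.restrict (Metric.ball c r)) :=
    (hgl.aestronglyMeasurable.sub (continuous_polyVal P).aestronglyMeasurable).restrict
  rw [ENNReal.toReal_mul, ENNReal.toReal_ofReal (by positivity),
    ← integral_norm_eq_lintegral_enorm hm,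
    rpow_volume_real_ball c hr] at h2
  refine h2.trans (le_of_eq ?_)
  ring

theorem exists_lipschitz_of_mem_campanato {n : ℕ} (hn : 1 ≤ n) {p : ℝ} (hp0 : 0 < p) (hp1 : p < 1) :
    ∃ C : ℝ, 0 < C ∧ ∀ g : Rn n → ℂ, MemLp g ∞ volume → g ∈ campanatoPhiPSpace n p →
      ∃ w : Rn n → ℂ, Continuous w ∧ g =ᵐ[volume] w ∧
        (∀ x, ‖w x‖ ≤ C * ((eLpNorm g ∞ volume).toReal + (campanatoPhiPENorm p g).toReal)) ∧
        ∀ h x, ‖(fwdDiff h)^[⌊(n : ℝ) * (1 / p - 1)⌋₊ + 1] w x‖ ≤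
          C * ((eLpNorm g ∞ volume).toReal + (campanatoPhiPENorm p g).toReal) *
            ‖h‖ ^ ((n : ℝ) * (1 / p - 1)) := by
  have hα : 0 < 1 / p - 1 := sub_pos.2 ((one_lt_div hp0).2 hp1)
  have ha : 0 < (n : ℝ) * (1 / p - 1) := mul_pos (by exact_mod_cast hn) hα
  set v : ℝ := volume.real (Metric.ball (0 : Rn n) 1) with hv
  have hv0 : 0 < v := volume_real_ball_pos 0 one_pos
  obtain ⟨C, hC, H⟩ := exists_lipschitz_of_campanato n
    (Nat.succ_pos ⌊(n : ℝ) * (1 / p - 1)⌋₊) ha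
    -- Below this radius a ball has volume less than one, so it falls under the small-ball supremum:
    -- `r ≤ 1` gives `r^n v ≤ r v < 1`.
    (r₀ := 1 / (v + 1)) (by positivity)
  refine ⟨1 + C * (1 + v ^ (1 / p - 1)), by positivity, fun g hg hgc => ?_⟩
  set L := (eLpNorm g ∞ volume).toReal with hL
  set N := (campanatoPhiPENorm p g).toReal with hN
  have hL0 : 0 ≤ L := ENNReal.toReal_nonneg
  have hN0 : 0 ≤ N := ENNReal.toReal_nonneg
  have hgL := ae_norm_le_toReal_eLpNorm_top hg.2.ne
  obtain ⟨w, hwc, hgw, hwD⟩ := H g L (v ^ (1 / p - 1) * N) hgc.1 (by positivity) hL0 hgL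
    fun c r hr hr₀ => integral_norm_le_of_campanato hp0 hp1 hgc c hr (by
      rw [volume_ball_eq_ofReal, ENNReal.ofReal_lt_one, volume_real_ball c hr]
      rw [lt_div_iff₀ (by positivity)] at hr₀
      have hr1 : r ≤ 1 := by nlinarith
      have := pow_le_of_le_one hr.le hr1 (by omega : n ≠ 0)
      calc r ^ n * v ≤ r * v := by gcongr
        _ < 1 := by nlinarith)
  refine ⟨w, hwc, hgw, norm_le_of_ae_norm_le hwc ?_, fun h x => (hwD h x).trans ?_⟩
  · filter_upwards [hgw, hgL] with x h1 h2
    rw [← h1]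
    refine h2.trans (le_trans (le_add_of_nonneg_right hN0) ?_)
    exact le_mul_of_one_le_left (by positivity) (le_add_of_nonneg_right (by positivity))
  · refine mul_le_mul_of_nonneg_right ?_ (by positivity)
    have h1 : 0 ≤ v ^ (1 / p - 1) * L := by positivity
    calc C * (L + v ^ (1 / p - 1) * N) ≤ C * ((1 + v ^ (1 / p - 1)) * (L + N)) := by
          gcongr
          nlinarith
      _ ≤ _ := by
          rw [← mul_assoc]
          gcongr
          linarith

theorem lipschitzENorm_mul_le {n : ℕ} (hn : 1 ≤ n) {p : ℝ} (hp0 : 0 < p) (hp1 : p < 1) :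
    ∃ C : ℝ≥0, 0 < C ∧ ∀ g : Rn n → ℂ, MemLp g ∞ volume → g ∈ campanatoPhiPSpace n p →
      ∀ f ∈ lipschitzSpace n ((n : ℝ) * (1 / p - 1)),
        lipschitzENorm ((n : ℝ) * (1 / p - 1)) (fun x => g x * f x) ≤
          C * (eLpNorm g ∞ volume + campanatoPhiPENorm p g) *
            lipschitzENorm ((n : ℝ) * (1 / p - 1)) f := by
  have hα : 0 < 1 / p - 1 := sub_pos.2 ((one_lt_div hp0).2 hp1)
  have ha : 0 < (n : ℝ) * (1 / p - 1) := mul_pos (by exact_mod_cast hn) hα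
  obtain ⟨C, hC, H⟩ := exists_lipschitz_of_mem_campanato hn hp0 hp1
  set a : ℝ := (n : ℝ) * (1 / p - 1) with hadef
  have haM : a < (⌊a⌋₊ + 1 : ℕ) := by exact_mod_cast Nat.lt_floor_add_one a
  obtain ⟨C', hC', H'⟩ := iterate_fwdDiff_mul_le (E := Rn n) ha haM
  refine ⟨((1 + C') * C).toNNReal, Real.toNNReal_pos.2 (by positivity), fun g hg hgc f hf => ?_⟩
  obtain ⟨w, hwc, hgw, hwA, hwD⟩ := H g hg hgc
  obtain ⟨u, huc, hfu, huA, huD⟩ := exists_continuous_of_lipschitzENorm_lt_top hf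
  set A := C * ((eLpNorm g ∞ volume).toReal + (campanatoPhiPENorm p g).toReal) with hA
  set A' := (lipschitzENorm a f).toReal with hA'
  have hA0 : 0 ≤ A := (norm_nonneg _).trans (hwA 0)
  have hA'0 : 0 ≤ A' := ENNReal.toReal_nonneg
  have hprod : (fun x => g x * f x) =ᵐ[volume] fun x => w x * u x := by
    filter_upwards [hgw, hfu] with x h1 h2
    rw [h1, h2]
  have hbound : ∀ᵐ x, ‖g x * f x‖ ≤ A * A' := by
    filter_upwards [hprod] with x hx
    rw [hx, norm_mul]
    exact mul_le_mul (hwA x) (huA x) (norm_nonneg _) hA0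
  refine (lipschitzENorm_le_of_bounds (hwc.mul huc) hprod hbound
    (H' w u A A' hwA huA hwD huD)).trans (le_of_eq ?_)
  rw [← ENNReal.ofReal_add (by positivity) (by positivity)]
  have hval : A * A' + C' * A * A' = (1 + C') * C *
      ((eLpNorm g ∞ volume).toReal + (campanatoPhiPENorm p g).toReal) * A' := by
    rw [hA]
    ring
  rw [hval, ENNReal.ofReal_mul (by positivity), ENNReal.ofReal_mul (by positivity),
    ENNReal.ofReal_add ENNReal.toReal_nonneg ENNReal.toReal_nonneg,
    ENNReal.ofReal_toReal hg.2.ne, ENNReal.ofReal_toReal hgc.2.ne, hA',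
    ENNReal.ofReal_toReal (ne_of_lt hf)]
  rfl

/-! ### Lipschitz functions belong to the local Campanato space -/

theorem const_one_mem_lipschitzSpace (n : ℕ) (a : ℝ) :
    (fun _ => 1 : Rn n → ℂ) ∈ lipschitzSpace n a := by
  refine (lipschitzENorm_le_of_bounds (A := 1) (A' := 0) continuous_const
    Filter.EventuallyEq.rfl (by simp) fun h x => ?_).trans_lt
    (ENNReal.add_lt_top.2 ⟨ENNReal.ofReal_lt_top, ENNReal.ofReal_lt_top⟩)
  rw [Function.iterate_succ_apply, fwdDiff_const]
  simpa using norm_iterate_fwdDiff_le (u := fun _ : Rn n => (0 : ℂ)) (K := 0) (by simp) h x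

/-- On small balls, the oscillation bound `r^a |B|` matches the lower bound for the Orlicz norm. On
large balls, the trivial bound `A |B|` suffices, since the Orlicz norm is at least a constant times
`|B|`. -/
theorem mem_campanato_of_bounds {n : ℕ} (hn : 1 ≤ n) {p : ℝ} (hp0 : 0 < p) (hp1 : p < 1)
    {g u : Rn n → ℂ} (hu : Continuous u) (hgu : g =ᵐ[volume] u) {A : ℝ} (hA : 0 < A)
    (huA : ∀ x, ‖u x‖ ≤ A)
    (huD : ∀ h x, ‖(fwdDiff h)^[⌊(n : ℝ) * (1 / p - 1)⌋₊ + 1] u x‖ ≤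
      A * ‖h‖ ^ ((n : ℝ) * (1 / p - 1))) :
    g ∈ campanatoPhiPSpace n p := by
  have hq : 1 ≤ 1 / p := (one_le_div hp0).2 hp1.le
  have hα : 0 < 1 / p - 1 := sub_pos.2 ((one_lt_div hp0).2 hp1)
  have ha : 0 < (n : ℝ) * (1 / p - 1) := mul_pos (by exact_mod_cast hn) hα
  have hgl : LocallyIntegrable g volume := hu.locallyIntegrable.congr hgu.symm
  set v : ℝ := volume.real (Metric.ball (0 : Rn n) 1) with hv
  have hv0 : 0 < v := volume_real_ball_pos 0 one_pos
  obtain ⟨C, hC, H⟩ := integral_norm_sub_minimizingPoly_le n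
    (Nat.succ_pos ⌊(n : ℝ) * (1 / p - 1)⌋₊) ha
  set K : ℝ := C * A * (v ^ (1 / p - 1))⁻¹ * 2 ^ (1 / p) with hK
  have hvα : 0 < v ^ (1 / p - 1) := by positivity
  -- For `V ≥ 1` this constant works for both entries of the minimum: `V^(1/p) ≥ V` handles the
  -- first, and `κ ≤ 1/2` the second.
  set κ : ℝ := (1 / 2) ^ (1 / p) with hκ
  have hκ0 : 0 < κ := by positivity
  refine ⟨hgl, lt_of_le_of_lt (add_le_add (b := ENNReal.ofReal K) (d := ENNReal.ofReal (A / κ))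
    (iSup_le fun c => iSup_le fun r => iSup_le fun hr => iSup_le fun hB => ?_)
    (iSup_le fun c => iSup_le fun r => iSup_le fun hr => iSup_le fun hB => ?_))
    (ENNReal.add_lt_top.2 ⟨ENNReal.ofReal_lt_top, ENNReal.ofReal_lt_top⟩)⟩
  · set P := minimizingPoly ⌊(n : ℝ) * (1 / p - 1)⌋₊ (Metric.ball c r) g with hP
    have hmin := isMinimizingPoly_minimizingPoly ⌊(n : ℝ) * (1 / p - 1)⌋₊ hgl c hr
    have hmin' : IsMinimizingPoly ⌊(n : ℝ) * (1 / p - 1)⌋₊ (Metric.ball c r) u P := by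
      refine ⟨hmin.1, fun R hR => ?_⟩
      rw [← hmin.2 R hR]
      refine integral_congr_ae ?_
      filter_upwards [ae_restrict_of_ae hgu] with x hx
      rw [hx]
    have hosc := H u A hu hA huD c r P hr hmin'
    set V := volume.real (Metric.ball c r) with hV
    have hV0 : 0 < V := volume_real_ball_pos c hr
    rw [volume_ball_eq_ofReal, ENNReal.ofReal_lt_one, ← hV] at hB
    have hlux := le_luxemburgENorm_indicator hp0 hp1 (measurableSet_ball (x := c) (ε := r)) hV0
      (volume_ball_eq_ofReal c r)
    rw [min_eq_left (Real.rpow_le_self_of_le_one (by positivity) (by linarith) hq)] at hlux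
    refine ENNReal.div_le_of_le_mul (le_trans ?_ (mul_le_mul_right hlux _))
    rw [← ENNReal.ofReal_mul (by positivity)]
    have hint : IntegrableOn (fun x => u x - polyVal P x) (Metric.ball c r) :=
      ((hu.sub (continuous_polyVal P)).continuousOn.integrableOn_compact
        (isCompact_closedBall c r)).mono_set Metric.ball_subset_closedBall
    have h1 : ∫⁻ x in Metric.ball c r, ‖g x - polyVal P x‖ₑ =
        ENNReal.ofReal (∫ x in Metric.ball c r, ‖u x - polyVal P x‖) := by
      rw [ofReal_integral_norm_eq_lintegral_enorm hint]
      refine lintegral_congr_ae ?_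
      filter_upwards [ae_restrict_of_ae hgu] with x hx
      rw [hx]
    rw [h1]
    refine ENNReal.ofReal_le_ofReal (hosc.trans (le_of_eq ?_))
    have h2 := rpow_volume_real_ball c hr p
    rw [← hV, ← hv] at h2
    rw [Real.div_rpow hV0.le zero_le_two, h2, hK]
    have h3 : (0 : ℝ) < 2 ^ (1 / p) := by positivity
    field_simp
  · set V := volume.real (Metric.ball c r) with hV
    have hV0 : 0 < V := volume_real_ball_pos c hr
    have hV1 : 1 ≤ V := by
      rw [volume_ball_eq_ofReal] at hB
      exact ENNReal.one_le_ofReal.1 hB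
    have hlux := le_luxemburgENorm_indicator hp0 hp1 (measurableSet_ball (x := c) (ε := r)) hV0
      (volume_ball_eq_ofReal c r)
    have hmin : κ * V ≤ min ((V / 2) ^ (1 / p)) (V / 2) := by
      refine le_min ?_ ?_
      · rw [div_eq_mul_one_div, Real.mul_rpow hV0.le (by norm_num), mul_comm]
        gcongr
        exact Real.self_le_rpow_of_one_le hV1 hq
      · have : κ ≤ 1 / 2 := Real.rpow_le_self_of_le_one (by norm_num) (by norm_num) hq
        nlinarith
    refine ENNReal.div_le_of_le_mul (le_trans ?_
      (mul_le_mul_right ((ENNReal.ofReal_le_ofReal hmin).trans hlux) _))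
    rw [← ENNReal.ofReal_mul (by positivity), ← mul_assoc, div_mul_cancel₀ _ hκ0.ne',
      ENNReal.ofReal_mul hA.le, ← volume_ball_eq_ofReal, ← setLIntegral_const]
    refine lintegral_mono_ae ?_
    filter_upwards [ae_restrict_of_ae hgu] with x hx
    rw [hx, ← ofReal_norm]
    exact ENNReal.ofReal_le_ofReal (huA x)

/-- The constant function `1` has finite Lipschitz norm, so `g = g · 1` does too; its continuous
representative then satisfies both conclusions. -/
theorem mem_of_isLipschitzMultiplier {n : ℕ} (hn : 1 ≤ n) {p : ℝ} (hp0 : 0 < p) (hp1 : p < 1)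
    {g : Rn n → ℂ} (hg : IsLipschitzMultiplier ((n : ℝ) * (1 / p - 1)) g) :
    MemLp g ∞ volume ∧ g ∈ campanatoPhiPSpace n p := by
  obtain ⟨C, -, H⟩ := hg
  have h1 := const_one_mem_lipschitzSpace n ((n : ℝ) * (1 / p - 1))
  have hfin : lipschitzENorm ((n : ℝ) * (1 / p - 1)) g < ∞ := by
    have h2 := H _ h1
    simp only [mul_one] at h2
    exact h2.trans_lt (ENNReal.mul_lt_top ENNReal.coe_lt_top h1)
  obtain ⟨u, huc, hgu, huA, huD⟩ := exists_continuous_of_lipschitzENorm_lt_top hfin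
  set A := (lipschitzENorm ((n : ℝ) * (1 / p - 1)) g).toReal
  have hA0 : 0 ≤ A := ENNReal.toReal_nonneg
  refine ⟨(memLp_congr_ae hgu).2 (memLp_top_of_bound huc.aestronglyMeasurable A
    (Filter.Eventually.of_forall huA)),
    mem_campanato_of_bounds hn hp0 hp1 huc hgu (A := A + 1) (by positivity)
      (fun x => (huA x).trans (by linarith)) fun h x => (huD h x).trans ?_⟩
  gcongr
  linarith

end PointwiseMultiplier

end

/-! ### Characterization of the pointwise multipliers -/

theorem mainTheorem2 (n : ℕ) (hn : 1 ≤ n) (p : ℝ) (hp0 : 0 < p) (hp1 : p < 1) :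
    ∃ C : ℝ≥0, 0 < C ∧ ∀ g : PointwiseMultiplier.Rn n → ℂ,
      ((MemLp g ∞ volume ∧ g ∈ PointwiseMultiplier.campanatoPhiPSpace n p) ↔
        PointwiseMultiplier.IsLipschitzMultiplier ((n : ℝ) * (1 / p - 1)) g) ∧
      ((MemLp g ∞ volume ∧ g ∈ PointwiseMultiplier.campanatoPhiPSpace n p) →
        ∀ f ∈ PointwiseMultiplier.lipschitzSpace n ((n : ℝ) * (1 / p - 1)),
          PointwiseMultiplier.lipschitzENorm ((n : ℝ) * (1 / p - 1)) (fun x => g x * f x) ≤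
            C * (eLpNorm g ∞ volume + PointwiseMultiplier.campanatoPhiPENorm p g) *
              PointwiseMultiplier.lipschitzENorm ((n : ℝ) * (1 / p - 1)) f) := by
  obtain ⟨C, hC, H⟩ := PointwiseMultiplier.lipschitzENorm_mul_le hn hp0 hp1
  refine ⟨C, hC, fun g => ⟨⟨fun hg => ?_, fun hg =>
    PointwiseMultiplier.mem_of_isLipschitzMultiplier hn hp0 hp1 hg⟩, fun hg => H g hg.1 hg.2⟩⟩
  have hfin : (C : ℝ≥0∞) * (eLpNorm g ∞ volume + PointwiseMultiplier.campanatoPhiPENorm p g) ≠ ∞ :=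
    ENNReal.mul_ne_top ENNReal.coe_ne_top (ENNReal.add_ne_top.2 ⟨hg.1.2.ne, hg.2.2.ne⟩)
  -- Adding one keeps the multiplier constant positive even when `g` vanishes almost everywhere.
  refine ⟨((C : ℝ≥0∞) * (eLpNorm g ∞ volume +
    PointwiseMultiplier.campanatoPhiPENorm p g)).toNNReal + 1, by positivity, fun f hf =>
      (H g hg.1 hg.2 f hf).trans ?_⟩
  rw [ENNReal.coe_add, ENNReal.coe_toNNReal hfin]
  gcongr
  exact le_self_add
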